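/- Let $G$ be a finite group. A $G$-Tambara functor $R$ assigns a commutative ring $R(X)$ to every finite $G$-set $X$, and to every $G$-equivariant map $f : X \to Y$ a ring homomorphism $f^* : R(Y) \to R(X)$ (restriction), an additive map $f_+ : R(X) \to R(Y)$ (transfer) and a multiplicative map $f_\bullet : R(X) \to R(Y)$ (norm), all functorial, such that $R$ takes finite disjoint unions to products, transfers and norms satisfy base change along pullback squares, and norms distribute over transfers along exponential diagrams. A Tambara ideal $I$ of $R$ is a family of ideals $I(G/H) \subseteq R(G/H)$, $H \le G$, that is closed under the restrictions, transfers and norms along all equivariant maps between orbits; the product $I \cdot J$ is the Tambara ideal generated by all $ab$ with $a \in I(G/H)$, $b \in J(G/H)$, $H \le G$. A proper Tambara ideal $\mathfrak p$ is prime if $I \cdot J \subseteq \mathfrak p$ implies $I \subseteq \mathfrak p$ or $J \subseteq \mathfrak p$, for all Tambara ideals $I, J$; and $R$ is domain-like if its zero ideal is prime. The group $G$ acts on $R(G/e)$, with $g$ acting by restriction along right multiplication by $g$ on $G/e$; $R$ is clarified if there are no nonzero idempotent $d \in R(G/e)$ and $g \in G$ with $d \cdot gd = 0$. For a subgroup $H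 \le G$ and an $H$-Tambara functor $S$, the coinduction $\mathrm{CoInd}_H^G S$ is the $G$-Tambara functor $X \mapsto S(\mathrm{Res}_H^G X)$. Theorem. Let $G$ be a finite group and $R$ a $G$-Tambara functor. Then $R$ is domain-like if and only if there are a subgroup $H \le G$ and a clarified domain-like $H$-Tambara functor $R_H$ such that $R \cong \mathrm{CoInd}_H^G R_H$ as $G$-Tambara functors. The case $H = G$, in which $R$ itself is clarified, is allowed. -/

import Mathlib

universe u v

/-- A finite `G`-set. -/
structure FinGSet (G : Type u) [Group G] : Type (u + 1) where
  carrier : Type u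
  [action : MulAction G carrier]
  [finite : Finite carrier]

namespace FinGSet

variable {G : Type u} [Group G]

instance : CoeSort (FinGSet G) (Type u) := ⟨FinGSet.carrier⟩

attribute [instance] FinGSet.action FinGSet.finite

/-- The orbit `G / H` of a finite group `G`. -/
def orbit [Finite G] (H : Subgroup G) : FinGSet G := ⟨G ⧸ H⟩

/-- The empty `G`-set. -/
def empty (G : Type u) [Group G] : FinGSet G where
  carrier := PEmpty
  action :=
    { smul := fun _ x => x.elim
      one_smul := fun x => x.elim
      mul_smul := fun _ _ x => x.elim }

/-- Right multiplication by `g`, as a `G`-equivariant self-map of `G / e`. -/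
def rightMul [Finite G] (g : G) :
    (orbit (⊥ : Subgroup G) : FinGSet G) →[G] (orbit (⊥ : Subgroup G) : FinGSet G) where
  toFun := Quotient.map' (fun x : G => x * g) (by
    intro a b h
    rw [QuotientGroup.leftRel_apply, Subgroup.mem_bot, inv_mul_eq_one] at h ⊢
    rw [h])
  map_smul' := by
    intro a x
    induction x using QuotientGroup.induction_on with
    | H z => exact congrArg (QuotientGroup.mk (s := (⊥ : Subgroup G))) (mul_assoc a z g)

/-- The underlying `H`-set of a `G`-set. -/
def restrict (H : Subgroup G) (X : FinGSet G) : FinGSet H := ⟨X.carrier⟩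

/-- A `G`-equivariant map, regarded as an `H`-equivariant map. -/
def restrictMap (H : Subgroup G) {X Y : FinGSet G} (f : X →[G] Y) :
    restrict H X →[H] restrict H Y where
  toFun := f
  map_smul' h x := f.map_smul (h : G) x

/-- The square with sides `a : P → A`, `b : P → B`, `f : A → C`, `g : B → C` is a pullback square
of finite `G`-sets. -/
def IsCartesian {P A B C : FinGSet G} (a : P →[G] A) (b : P →[G] B) (f : A →[G] C)
    (g : B →[G] C) : Prop :=
  (∀ w, f (a w) = g (b w)) ∧ ∀ x y, f x = g y → ∃! w, a w = x ∧ b w = y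

/-- `Z` is the disjoint union of `X` and `Y`, with inclusions `i` and `j`. -/
def IsDisjointUnion {X Y Z : FinGSet G} (i : X →[G] Z) (j : Y →[G] Z) : Prop :=
  Function.Bijective (Sum.elim i j : X ⊕ Y → Z)

/-- The exponential diagram on `p : A → X` and `f : X → Y`:
```
  X <--p-- A <--e-- P
  |                 |
  f                 f'
  v                 v
  Y <------q------- Q
```
The outer square is a pullback, and the points of `Q` over `y : Y` correspond bijectively to the
sections `s` of `p` over the fibre `f ⁻¹ y`; here `z : Q` corresponds to the section that sends `x`
to `e w`, where `w` is the point of `P = X ×_Y Q` that lies over `x` and `z`. So `Q` is the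
dependent product of `A` along `f`, and `e` is the evaluation map. -/
def IsExponential {A X Y P Q : FinGSet G} (p : A →[G] X) (f : X →[G] Y) (e : P →[G] A)
    (f' : P →[G] Q) (q : Q →[G] Y) : Prop :=
  IsCartesian (p.comp e) f' f q ∧
    ∀ (y : Y) (s : {x : X // f x = y} → A), (∀ x, p (s x) = x) →
      ∃! z : Q, q z = y ∧
        ∀ (x : {x : X // f x = y}) (w : P), f' w = z → p (e w) = x → e w = s x

end FinGSet

/-- A `G`-Tambara functor: commutative rings `R(X)` for all finite `G`-sets `X`, with restrictions,
transfers and norms along all equivariant maps, such that `R` takes finite disjoint unions to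
products, transfers and norms satisfy base change along pullback squares, and norms distribute over
transfers as prescribed by exponential diagrams. -/
structure TambaraFunctor (G : Type u) [Group G] where
  obj : FinGSet G → Type v
  [commRing : ∀ X, CommRing (obj X)]
  res : ∀ {X Y : FinGSet G}, (X →[G] Y) → obj Y →+* obj X
  tr : ∀ {X Y : FinGSet G}, (X →[G] Y) → obj X →+ obj Y
  nm : ∀ {X Y : FinGSet G}, (X →[G] Y) → obj X →* obj Y
  res_id : ∀ {X : FinGSet G} (a : obj X), res (MulActionHom.id G) a = a
  tr_id : ∀ {X : FinGSet G} (a : obj X), tr (MulActionHom.id G) a = a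
  nm_id : ∀ {X : FinGSet G} (a : obj X), nm (MulActionHom.id G) a = a
  res_comp : ∀ {X Y Z : FinGSet G} (g : Y →[G] Z) (f : X →[G] Y) (a : obj Z),
    res (g.comp f) a = res f (res g a)
  tr_comp : ∀ {X Y Z : FinGSet G} (g : Y →[G] Z) (f : X →[G] Y) (a : obj X),
    tr (g.comp f) a = tr g (tr f a)
  nm_comp : ∀ {X Y Z : FinGSet G} (g : Y →[G] Z) (f : X →[G] Y) (a : obj X),
    nm (g.comp f) a = nm g (nm f a)
  subsingleton_of_isEmpty : ∀ X : FinGSet G, IsEmpty X → Subsingleton (obj X)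
  bijective_of_isDisjointUnion : ∀ {X Y Z : FinGSet G} (i : X →[G] Z) (j : Y →[G] Z),
    FinGSet.IsDisjointUnion i j → Function.Bijective (fun a : obj Z => (res i a, res j a))
  res_tr : ∀ {P A B C : FinGSet G} (a : P →[G] A) (b : P →[G] B) (f : A →[G] C) (g : B →[G] C),
    FinGSet.IsCartesian a b f g → ∀ t : obj A, res g (tr f t) = tr b (res a t)
  res_nm : ∀ {P A B C : FinGSet G} (a : P →[G] A) (b : P →[G] B) (f : A →[G] C) (g : B →[G] C),
    FinGSet.IsCartesian a b f g → ∀ t : obj A, res g (nm f t) = nm b (res a t)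
  nm_tr : ∀ {A X Y P Q : FinGSet G} (p : A →[G] X) (f : X →[G] Y) (e : P →[G] A)
    (f' : P →[G] Q) (q : Q →[G] Y), FinGSet.IsExponential p f e f' q →
      ∀ t : obj A, nm f (tr p t) = tr q (nm f' (res e t))

namespace TambaraFunctor

variable {G : Type u} [Group G]

attribute [instance] TambaraFunctor.commRing

/-- An isomorphism of `G`-Tambara functors. -/
structure Iso (R S : TambaraFunctor.{u, v} G) where
  equiv : ∀ X : FinGSet G, R.obj X ≃+* S.obj X
  map_res : ∀ {X Y : FinGSet G} (f : X →[G] Y) (a : R.obj Y),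
    equiv X (R.res f a) = S.res f (equiv Y a)
  map_tr : ∀ {X Y : FinGSet G} (f : X →[G] Y) (a : R.obj X),
    equiv Y (R.tr f a) = S.tr f (equiv X a)
  map_nm : ∀ {X Y : FinGSet G} (f : X →[G] Y) (a : R.obj X),
    equiv Y (R.nm f a) = S.nm f (equiv X a)

/-- The coinduced `G`-Tambara functor `CoInd_H^G S`, whose value at a finite `G`-set `X` is the
value of `S` at the underlying `H`-set of `X`. -/
def coind (H : Subgroup G) (S : TambaraFunctor.{u, v} H) : TambaraFunctor.{u, v} G where
  obj X := S.obj (X.restrict H)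
  res f := S.res (FinGSet.restrictMap H f)
  tr f := S.tr (FinGSet.restrictMap H f)
  nm f := S.nm (FinGSet.restrictMap H f)
  res_id := S.res_id
  tr_id := S.tr_id
  nm_id := S.nm_id
  res_comp g f := S.res_comp (FinGSet.restrictMap H g) (FinGSet.restrictMap H f)
  tr_comp g f := S.tr_comp (FinGSet.restrictMap H g) (FinGSet.restrictMap H f)
  nm_comp g f := S.nm_comp (FinGSet.restrictMap H g) (FinGSet.restrictMap H f)
  subsingleton_of_isEmpty X h := S.subsingleton_of_isEmpty (X.restrict H) h
  bijective_of_isDisjointUnion i j h :=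
    S.bijective_of_isDisjointUnion (FinGSet.restrictMap H i) (FinGSet.restrictMap H j) h
  res_tr _ _ _ _ h := S.res_tr _ _ _ _ h
  res_nm _ _ _ _ h := S.res_nm _ _ _ _ h
  nm_tr _ _ _ _ _ h := S.nm_tr _ _ _ _ _ h

section Ideals

variable [Finite G]

/-- A Tambara ideal: ideals `I(G/H)` of `R(G/H)` for all subgroups `H`, closed under restriction,
transfer and norm along all equivariant maps between orbits. These maps are exactly the composites
of the projections `G/K → G/H` for `K ≤ H` and the conjugation isomorphisms. -/
@[ext]
structure TambaraIdeal (R : TambaraFunctor.{u, v} G) where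
  ideal : ∀ H : Subgroup G, Ideal (R.obj (FinGSet.orbit H))
  res_mem : ∀ {K H : Subgroup G} (f : FinGSet.orbit K →[G] FinGSet.orbit H)
    {a : R.obj (FinGSet.orbit H)}, a ∈ ideal H → R.res f a ∈ ideal K
  tr_mem : ∀ {K H : Subgroup G} (f : FinGSet.orbit K →[G] FinGSet.orbit H)
    {a : R.obj (FinGSet.orbit K)}, a ∈ ideal K → R.tr f a ∈ ideal H
  nm_mem : ∀ {K H : Subgroup G} (f : FinGSet.orbit K →[G] FinGSet.orbit H)
    {a : R.obj (FinGSet.orbit K)}, a ∈ ideal K → R.nm f a ∈ ideal H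

/-- Norms along maps of orbits preserve zero. -/
theorem nm_orbit_zero (R : TambaraFunctor.{u, v} G) {K H : Subgroup G}
    (f : FinGSet.orbit K →[G] FinGSet.orbit H) : R.nm f 0 = 0 := by
  let E : FinGSet G := FinGSet.empty G
  have hE : Subsingleton (R.obj E) := R.subsingleton_of_isEmpty E (inferInstanceAs (IsEmpty PEmpty))
  let p : ∀ X : FinGSet G, E →[G] X := fun X =>
    { toFun := fun x => PEmpty.elim x, map_smul' := fun _ x => PEmpty.elim x }
  have hf : Function.Surjective f := by
    intro y
    have : MulAction.IsPretransitive G (FinGSet.orbit H) :=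
      inferInstanceAs (MulAction.IsPretransitive G (G ⧸ H))
    let x : FinGSet.orbit K := ((1 : G) : G ⧸ K)
    obtain ⟨g, hg⟩ := MulAction.exists_smul_eq G (f x) y
    exact ⟨g • x, by rw [map_smul, hg]⟩
  have h : FinGSet.IsExponential (p (FinGSet.orbit K)) f (p E) (p E) (p (FinGSet.orbit H)) := by
    refine ⟨⟨fun w => PEmpty.elim w, fun _ y => PEmpty.elim y⟩, fun y s _ => ?_⟩
    obtain ⟨x, hx⟩ := hf y
    exact PEmpty.elim (s ⟨x, hx⟩)
  have h1 := R.nm_tr _ _ _ _ _ h 0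
  rw [map_zero] at h1
  rw [h1, Subsingleton.elim (R.nm (p E) (R.res (p E) 0)) 0, map_zero]

namespace TambaraIdeal

variable {R : TambaraFunctor.{u, v} G}

/-- Inclusion of Tambara ideals. -/
instance : LE (TambaraIdeal R) := ⟨fun I J => ∀ H, I.ideal H ≤ J.ideal H⟩

/-- The zero ideal. -/
instance : Bot (TambaraIdeal R) where
  bot :=
    { ideal := fun _ => ⊥
      res_mem := by
        intro K H f a ha
        rw [Ideal.mem_bot] at ha ⊢
        rw [ha, map_zero]
      tr_mem := by
        intro K H f a ha
        rw [Ideal.mem_bot] at ha ⊢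
        rw [ha, map_zero]
      nm_mem := by
        intro K H f a ha
        rw [Ideal.mem_bot] at ha ⊢
        rw [ha, nm_orbit_zero] }

/-- The Tambara ideal generated by a set of elements in each level: the intersection of all
Tambara ideals that contain these elements. -/
def span (s : ∀ H : Subgroup G, Set (R.obj (FinGSet.orbit H))) : TambaraIdeal R where
  ideal H := ⨅ (I : TambaraIdeal R) (_ : ∀ L, s L ⊆ I.ideal L), I.ideal H
  res_mem := by
    intro K H f a ha
    simp only [Submodule.mem_iInf] at ha ⊢
    exact fun I hI => I.res_mem f (ha I hI)
  tr_mem := by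
    intro K H f a ha
    simp only [Submodule.mem_iInf] at ha ⊢
    exact fun I hI => I.tr_mem f (ha I hI)
  nm_mem := by
    intro K H f a ha
    simp only [Submodule.mem_iInf] at ha ⊢
    exact fun I hI => I.nm_mem f (ha I hI)

/-- The product of Tambara ideals: the Tambara ideal generated by the levelwise products. -/
instance : Mul (TambaraIdeal R) :=
  ⟨fun I J => span fun H => {x | ∃ a ∈ I.ideal H, ∃ b ∈ J.ideal H, x = a * b}⟩

/-- A proper Tambara ideal `P` is prime if `I * J ≤ P` implies `I ≤ P` or `J ≤ P`. -/
def IsPrime (P : TambaraIdeal R) : Prop :=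
  (∃ H, P.ideal H ≠ ⊤) ∧ ∀ I J : TambaraIdeal R, I * J ≤ P → I ≤ P ∨ J ≤ P

end TambaraIdeal

/-- `R` is domain-like if its zero ideal is prime. -/
def IsDomainLike (R : TambaraFunctor.{u, v} G) : Prop :=
  (⊥ : TambaraIdeal R).IsPrime

/-- The action of `g : G` on `R(G/e)`: restriction along right multiplication by `g`. -/
def conjAct (R : TambaraFunctor.{u, v} G) (g : G) :
    R.obj (FinGSet.orbit (⊥ : Subgroup G)) →+* R.obj (FinGSet.orbit (⊥ : Subgroup G)) :=
  R.res (FinGSet.rightMul g)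

/-- `R` is clarified if there is no nonzero idempotent `d` in `R(G/e)` with `d * g d = 0` for
some `g : G`. -/
def IsClarified (R : TambaraFunctor.{u, v} G) : Prop :=
  ¬ ∃ d : R.obj (FinGSet.orbit (⊥ : Subgroup G)),
    d ≠ 0 ∧ IsIdempotentElem d ∧ ∃ g : G, d * R.conjAct g d = 0

end Ideals

end TambaraFunctor

/-!
Let `G` act on `R(G/e)`, and choose a nonzero idempotent `d` for which `{g | d * g • d ≠ 0}` cannot
be shrunk by passing to a smaller nonzero idempotent. Minimality makes this set a subgroup `H`, and
replacing `d` by the product of its translates under `H` makes it fixed by `H` while keeping it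
orthogonal to its translates by elements outside `H`.

Let `e` be the norm of `d` to `R(G/H)`. Its restrictions form a family of idempotents that is
compatible with the Tambara structure over `H`, and its transfer `t` to `R(G/G)` is idempotent. The
restriction of `t` to `R(G/e)` is a nonzero idempotent fixed by `G`. Such an idempotent generates a
Tambara ideal whose product with its annihilator vanishes, so when `R` is domain-like it equals
`1`. Norming this equality up to `R(G/G)` and expanding by the distributive law shows that already
`t = 1`.

Since `e` is orthogonal to its translates, `R` is then coinduced from the corner cut out by `e` in
the restriction of `R` to `H`, and minimality makes this corner clarified. Finally, Tambara ideals
can be moved along coinduction in both directions, so `R` is domain-like if and only if the corner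
is.
-/

/-! ### Idempotents in a ring with an action of a finite group -/

section Idempotents

variable {G A : Type*} [Group G] [CommRing A] [MulSemiringAction G A]

/-- `d` is an idempotent that is fixed by `H` and orthogonal to its translates by elements outside
`H`. Its translates are then orthogonal idempotents indexed by `G / H`: a system of imprimitivity,
except that they need not add up to `1`. -/
structure IsImprimitivityIdempotent (H : Subgroup G) (d : A) : Prop where
  isIdempotentElem : IsIdempotentElem d
  smul_eq : ∀ h ∈ H, h • d = d
  mul_smul_eq_zero : ∀ g ∉ H, d * g • d = 0

/-- `d` is a nonzero idempotent whose set `{g | d * g • d ≠ 0}` of overlaps does not shrink when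
`d` is replaced by a nonzero idempotent multiple. -/
structure IsOverlapMinimal (G : Type*) [Group G] [MulSemiringAction G A] (d : A) : Prop where
  ne_zero : d ≠ 0
  isIdempotentElem : IsIdempotentElem d
  mul_smul_ne_zero : ∀ d', d' ≠ 0 → IsIdempotentElem d' → d ∣ d' → ∀ g : G,
    d * g • d ≠ 0 → d' * g • d' ≠ 0

theorem mul_smul_dvd_mul_smul {d d' : A} (h : d ∣ d') (g : G) : d * g • d ∣ d' * g • d' :=
  mul_dvd_mul h (map_dvd (MulSemiringAction.toRingHom G A g) h)

theorem mul_smul_ne_zero_of_dvd {d d' : A} (h : d ∣ d') {g : G} (hg : d' * g • d' ≠ 0) :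
    d * g • d ≠ 0 :=
  ne_zero_of_dvd_ne_zero hg (mul_smul_dvd_mul_smul h g)

theorem isIdempotentElem_smul {d : A} (h : IsIdempotentElem d) (g : G) :
    IsIdempotentElem (g • d) :=
  h.map (MulSemiringAction.toRingHom G A g)

theorem mul_inv_smul_ne_zero {d : A} {g : G} (h : d * g • d ≠ 0) : d * g⁻¹ • d ≠ 0 := by
  rwa [← smul_ne_zero_iff_ne g, smul_mul', smul_inv_smul, mul_comm]

theorem exists_isOverlapMinimal (G A : Type*) [Group G] [CommRing A] [MulSemiringAction G A]
    [Finite G] [Nontrivial A] : ∃ d : A, IsOverlapMinimal G d := by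
  obtain ⟨d, ⟨hd, hdd⟩, hmin⟩ := exists_minimalFor_of_wellFoundedLT
    (fun d : A => d ≠ 0 ∧ IsIdempotentElem d) (fun d => {g : G | d * g • d ≠ 0})
    ⟨1, one_ne_zero, IsIdempotentElem.one⟩
  exact ⟨d, hd, hdd, fun d' hd' hdd' hdvd g hg =>
    hmin ⟨hd', hdd'⟩ (fun _ => mul_smul_ne_zero_of_dvd hdvd) hg⟩

namespace IsOverlapMinimal

variable {d : A} (hd : IsOverlapMinimal G d)
include hd

theorem mul_mul_smul_ne_zero {g h : G} (hg : d * g • d ≠ 0) (hh : d * h • d ≠ 0) :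
    d * (g * h) • d ≠ 0 := by
  have h' : (d * g⁻¹ • d) * h • (d * g⁻¹ • d) ≠ 0 :=
    hd.mul_smul_ne_zero _ (mul_inv_smul_ne_zero hg)
      (hd.isIdempotentElem.mul (isIdempotentElem_smul hd.isIdempotentElem _))
      (dvd_mul_right _ _) h hh
  have hdvd : g⁻¹ • (d * (g * h) • d) ∣ (d * g⁻¹ • d) * h • (d * g⁻¹ • d) := by
    rw [smul_mul', mul_smul, inv_smul_smul, smul_mul']
    exact mul_dvd_mul (dvd_mul_left _ _) (dvd_mul_right _ _)
  exact (smul_ne_zero_iff_ne g⁻¹).mp (ne_zero_of_dvd_ne_zero h' hdvd)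

/-- The overlaps of `d`, which form a subgroup by `mul_mul_smul_ne_zero`. -/
def overlaps : Subgroup G where
  carrier := {g | d * g • d ≠ 0}
  one_mem' := by simpa [hd.isIdempotentElem.eq] using hd.ne_zero
  mul_mem' := hd.mul_mul_smul_ne_zero
  inv_mem' := mul_inv_smul_ne_zero

theorem isIdempotentElem_prod_smul (s : Finset hd.overlaps) :
    IsIdempotentElem (∏ h ∈ s, h • d) := by
  rw [IsIdempotentElem, ← Finset.prod_mul_distrib]
  exact Finset.prod_congr rfl fun h _ => isIdempotentElem_smul hd.isIdempotentElem h

theorem mul_prod_smul_ne_zero (s : Finset hd.overlaps) : d * ∏ h ∈ s, h • d ≠ 0 := by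
  classical
  induction s using Finset.induction_on with
  | empty => simpa using hd.ne_zero
  | insert h s hs ih =>
    have hp := hd.mul_smul_ne_zero _ ih
      (hd.isIdempotentElem.mul (hd.isIdempotentElem_prod_smul s)) (dvd_mul_right _ _) h h.2
    refine ne_zero_of_dvd_ne_zero hp ?_
    rw [Finset.prod_insert hs, mul_left_comm, mul_comm, Subgroup.smul_def, smul_mul']
    exact mul_dvd_mul_left _ (dvd_mul_right _ _)

end IsOverlapMinimal

theorem exists_isImprimitivityIdempotent (G A : Type*) [Group G] [CommRing A]
    [MulSemiringAction G A] [Finite G] [Nontrivial A] :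
    ∃ (H : Subgroup G) (d : A), d ≠ 0 ∧ IsImprimitivityIdempotent H d ∧
      ∀ d', d' ≠ 0 → IsIdempotentElem d' → d ∣ d' → ∀ h ∈ H, d' * h • d' ≠ 0 := by
  obtain ⟨d, hd⟩ := exists_isOverlapMinimal G A
  have := Fintype.ofFinite hd.overlaps
  have hdvd : d ∣ ∏ h : hd.overlaps, h • d := by
    simpa using Finset.dvd_prod_of_mem (· • d) (Finset.mem_univ (1 : hd.overlaps))
  refine ⟨hd.overlaps, ∏ h : hd.overlaps, h • d,
    right_ne_zero_of_mul (hd.mul_prod_smul_ne_zero Finset.univ),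
    ⟨hd.isIdempotentElem_prod_smul _, fun h hh => ?_, fun g hg => ?_⟩,
    fun d' hd' hdd' hdvd' => ?_⟩
  · exact Finset.smul_prod_perm d (⟨h, hh⟩ : hd.overlaps)
  · exact of_not_not fun hne => hg (mul_smul_ne_zero_of_dvd hdvd hne)
  · exact hd.mul_smul_ne_zero d' hd' hdd' (hdvd.trans hdvd')

end Idempotents

namespace FinGSet

open scoped Pointwise

variable {G : Type u} [Group G]

/-! ### Constructions of finite `G`-sets -/

/-- The pullback of finite `G`-sets. -/
def pullback {A B C : FinGSet G} (f : A →[G] C) (g : B →[G] C) : FinGSet G where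
  carrier :=
    (⟨{p | f p.1 = g p.2}, fun c p (h : f p.1 = g p.2) => by
      simp only [Set.mem_ofPred_eq, Prod.smul_fst, Prod.smul_snd, map_smul, h]⟩ :
        SubMulAction G (A × B))

/-- The first projection of a pullback. -/
def pullbackFst {A B C : FinGSet G} (f : A →[G] C) (g : B →[G] C) : pullback f g →[G] A where
  toFun p := p.1.1
  map_smul' _ _ := rfl

/-- The second projection of a pullback. -/
def pullbackSnd {A B C : FinGSet G} (f : A →[G] C) (g : B →[G] C) : pullback f g →[G] B where
  toFun p := p.1.2
  map_smul' _ _ := rfl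

theorem isCartesian_pullback {A B C : FinGSet G} (f : A →[G] C) (g : B →[G] C) :
    IsCartesian (pullbackFst f g) (pullbackSnd f g) f g := by
  refine ⟨fun w => w.2, fun x y h => ⟨⟨(x, y), h⟩, ⟨rfl, rfl⟩, ?_⟩⟩
  rintro ⟨⟨x', y'⟩, h'⟩ ⟨rfl, rfl⟩
  rfl

theorem comp_pullbackFst {A B C : FinGSet G} (f : A →[G] C) (g : B →[G] C) :
    f.comp (pullbackFst f g) = g.comp (pullbackSnd f g) :=
  MulActionHom.ext (isCartesian_pullback f g).1

/-- The lift of a commutative square to the pullback. -/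
def pullbackLift {T A B C : FinGSet G} (f : A →[G] C) (g : B →[G] C) (a : T →[G] A) (b : T →[G] B)
    (h : ∀ t, f (a t) = g (b t)) : T →[G] pullback f g where
  toFun t := ⟨(a t, b t), h t⟩
  map_smul' c t := Subtype.ext (Prod.ext (map_smul a c t) (map_smul b c t))

theorem isCartesian_of_bijective {A B : FinGSet G} (f : A →[G] B) (hf : Function.Bijective f) :
    IsCartesian f f (MulActionHom.id G) (MulActionHom.id G) := by
  refine ⟨fun w => rfl, fun x y h => ?_⟩
  obtain ⟨w, rfl⟩ := hf.2 x
  exact ⟨w, ⟨rfl, h⟩, fun w' hw => hf.1 hw.1⟩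

theorem isCartesian_of_injective {A B : FinGSet G} (f : A →[G] B) (hf : Function.Injective f) :
    IsCartesian (MulActionHom.id G) (MulActionHom.id G) f f :=
  ⟨fun _ => rfl, fun x _ h => ⟨x, ⟨rfl, hf h⟩, fun _ hw => hw.1⟩⟩

/-- The disjoint union of finite `G`-sets. -/
def sum (X Y : FinGSet G) : FinGSet G := ⟨X ⊕ Y⟩

/-- The left inclusion into a disjoint union. -/
def inl (X Y : FinGSet G) : X →[G] sum X Y where
  toFun := Sum.inl
  map_smul' _ _ := rfl

/-- The right inclusion into a disjoint union. -/
def inr (X Y : FinGSet G) : Y →[G] sum X Y where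
  toFun := Sum.inr
  map_smul' _ _ := rfl

/-- The map out of a disjoint union given by two maps. -/
def sumElim {X Y Z : FinGSet G} (f : X →[G] Z) (g : Y →[G] Z) : sum X Y →[G] Z where
  toFun := Sum.elim f g
  map_smul' := by
    rintro a (x | x)
    · exact map_smul f a x
    · exact map_smul g a x

/-- The disjoint union of two maps. -/
def sumMap {X Y X' Y' : FinGSet G} (f : X →[G] X') (g : Y →[G] Y') : sum X Y →[G] sum X' Y' :=
  sumElim ((inl X' Y').comp f) ((inr X' Y').comp g)

theorem isCartesian_inl_sumMap {X Y X' Y' : FinGSet G} (f : X →[G] X') (g : Y →[G] Y') :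
    IsCartesian (inl X Y) f (sumMap f g) (inl X' Y') := by
  refine ⟨fun _ => rfl, ?_⟩
  rintro (x | y) x' h
  · exact ⟨x, ⟨rfl, Sum.inl.inj h⟩, fun w hw => Sum.inl.inj hw.1⟩
  · cases h

theorem isCartesian_inr_sumMap {X Y X' Y' : FinGSet G} (f : X →[G] X') (g : Y →[G] Y') :
    IsCartesian (inr X Y) g (sumMap f g) (inr X' Y') := by
  refine ⟨fun _ => rfl, ?_⟩
  rintro (x | y) x' h
  · cases h
  · exact ⟨y, ⟨rfl, Sum.inr.inj h⟩, fun w hw => Sum.inr.inj hw.1⟩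

theorem isDisjointUnion_sum (X Y : FinGSet G) : IsDisjointUnion (inl X Y) (inr X Y) := by
  have h : (Sum.elim (inl X Y) (inr X Y) : X ⊕ Y → sum X Y) = id := Sum.elim_inl_inr
  rw [IsDisjointUnion, h]
  exact Function.bijective_id

theorem isDisjointUnion_iff {X Y Z : FinGSet G} (i : X →[G] Z) (j : Y →[G] Z) :
    IsDisjointUnion i j ↔ (Function.Injective i ∧ Function.Injective j ∧ ∀ x y, i x ≠ j y) ∧
      ∀ z, (∃ x, i x = z) ∨ ∃ y, j y = z := by
  simp only [IsDisjointUnion, Function.Bijective, Sum.elim_injective, Function.Surjective,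
    Sum.exists, Sum.elim_inl, Sum.elim_inr]

/-- The `G`-set of points outside the image of a map. -/
def compl {X Z : FinGSet G} (i : X →[G] Z) : FinGSet G where
  carrier :=
    (⟨{z | ∀ x, i x ≠ z}, fun g z hz x hx => hz (g⁻¹ • x) (by
      rw [map_smul, hx, inv_smul_smul])⟩ : SubMulAction G Z)

/-- The inclusion of the complement of the image of a map. -/
def complIncl {X Z : FinGSet G} (i : X →[G] Z) : compl i →[G] Z where
  toFun z := z.1
  map_smul' _ _ := rfl

theorem isDisjointUnion_compl {X Z : FinGSet G} (i : X →[G] Z) (hi : Function.Injective i) :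
    IsDisjointUnion i (complIncl i) := by
  rw [isDisjointUnion_iff]
  refine ⟨⟨hi, Subtype.val_injective, fun x y => y.2 x⟩, fun z => ?_⟩
  by_cases h : ∃ x, i x = z
  · exact Or.inl h
  · exact Or.inr ⟨⟨z, not_exists.mp h⟩, rfl⟩

/-- The unique map out of the empty `G`-set. -/
def emptyMap (X : FinGSet G) : empty G →[G] X where
  toFun x := PEmpty.elim x
  map_smul' _ x := PEmpty.elim x

instance : IsEmpty (empty G) := inferInstanceAs (IsEmpty PEmpty)

theorem isCartesian_empty {X Y Z : FinGSet G} (i : X →[G] Z) (j : Y →[G] Z)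
    (h : ∀ x y, i x ≠ j y) : IsCartesian (emptyMap X) (emptyMap Y) i j :=
  ⟨fun w => PEmpty.elim w, fun x y e => (h x y e).elim⟩

/-! ### Exponential diagrams -/

theorem bijOn_smul {A X Y : FinGSet G} (p : A →[G] X) (f : X →[G] Y) {T : Set A} {y : Y}
    (h : Set.BijOn p T (f ⁻¹' {y})) (g : G) : Set.BijOn p (g • T) (f ⁻¹' {g • y}) := by
  refine ⟨?_, ?_, fun x hx => ?_⟩
  · rintro _ ⟨a, ha, rfl⟩
    have hfa : f (p a) = y := h.mapsTo ha
    simp only [Set.mem_preimage, Set.mem_singleton_iff, map_smul, hfa]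
  · rintro _ ⟨a, ha, rfl⟩ _ ⟨b, hb, rfl⟩ hab
    simp only [map_smul, smul_left_cancel_iff] at hab
    exact congrArg (g • ·) (h.injOn ha hb hab)
  · have hx' : f (g⁻¹ • x) = y := by rw [map_smul, hx, inv_smul_smul]
    obtain ⟨a, ha, hax⟩ := h.surjOn hx'
    exact ⟨g • a, Set.smul_mem_smul_set ha, by rw [map_smul, hax, smul_inv_smul]⟩

theorem bijOn_range {A X Y : Type*} {p : A → X} {f : X → Y} {y : Y} {s : {x // f x = y} → A}
    (hs : ∀ x, p (s x) = x) : Set.BijOn p (Set.range s) (f ⁻¹' {y}) := by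
  refine ⟨?_, ?_, fun x hx => ⟨s ⟨x, hx⟩, ⟨_, rfl⟩, hs _⟩⟩
  · rintro _ ⟨x, rfl⟩
    rw [Set.mem_preimage, hs]
    exact x.2
  · rintro _ ⟨x, rfl⟩ _ ⟨x', rfl⟩ h
    rw [hs, hs] at h
    rw [Subtype.ext h]

/-- The dependent product of `p : A → X` along `f : X → Y`. A section of `p` over the fibre of `f`
over `y` is encoded by its image, that is, by a subset of `A` that `p` maps bijectively onto this
fibre. -/
def depProd {A X Y : FinGSet G} (p : A →[G] X) (f : X →[G] Y) : FinGSet G where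
  carrier :=
    (⟨{z | Set.BijOn p z.2 (f ⁻¹' {z.1})}, fun g _ h => bijOn_smul p f h g⟩ :
      SubMulAction G (Y × Set A))

/-- The projection of a dependent product to its base. -/
def depProdBase {A X Y : FinGSet G} (p : A →[G] X) (f : X →[G] Y) : depProd p f →[G] Y where
  toFun z := z.1.1
  map_smul' _ _ := rfl

/-- The domain of the evaluation map of a dependent product: points of the sections. -/
def depProdEval {A X Y : FinGSet G} (p : A →[G] X) (f : X →[G] Y) : FinGSet G where
  carrier :=
    (⟨{w | w.1 ∈ w.2.1.2}, fun _ _ h => Set.smul_mem_smul_set h⟩ :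
      SubMulAction G (A × depProd p f))

/-- The evaluation map of a dependent product. -/
def depProdEvalFst {A X Y : FinGSet G} (p : A →[G] X) (f : X →[G] Y) : depProdEval p f →[G] A where
  toFun w := w.1.1
  map_smul' _ _ := rfl

/-- The projection of the domain of the evaluation map to the dependent product. -/
def depProdEvalSnd {A X Y : FinGSet G} (p : A →[G] X) (f : X →[G] Y) :
    depProdEval p f →[G] depProd p f where
  toFun w := w.1.2
  map_smul' _ _ := rfl

theorem isCartesian_depProdEval {A X Y : FinGSet G} (p : A →[G] X) (f : X →[G] Y) :
    IsCartesian (p.comp (depProdEvalFst p f)) (depProdEvalSnd p f) f (depProdBase p f) := by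
  refine ⟨fun w => w.1.2.2.mapsTo w.2, fun x z h => ?_⟩
  obtain ⟨a, ha, rfl⟩ := z.2.surjOn h
  refine ⟨⟨(a, z), ha⟩, ⟨rfl, rfl⟩, ?_⟩
  rintro ⟨⟨b, z'⟩, hb⟩ ⟨hba, hz⟩
  obtain rfl : z' = z := hz
  exact Subtype.ext (Prod.ext (z'.2.injOn hb ha hba) rfl)

theorem isExponential_depProd {A X Y : FinGSet G} (p : A →[G] X) (f : X →[G] Y) :
    IsExponential p f (depProdEvalFst p f) (depProdEvalSnd p f) (depProdBase p f) := by
  refine ⟨isCartesian_depProdEval p f, fun y s hs => ?_⟩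
  refine ⟨⟨(y, Set.range s), bijOn_range hs⟩, ⟨rfl, ?_⟩, ?_⟩
  · rintro x ⟨⟨a, _⟩, ha⟩ rfl hpa
    obtain ⟨x', hx'⟩ : a ∈ Set.range s := ha
    have hx : x'.1 = x.1 := by rw [← hs x', hx']; exact hpa
    exact hx'.symm.trans (congrArg s (Subtype.ext hx))
  · rintro ⟨⟨_, T⟩, hT⟩ ⟨rfl, hTs⟩
    have hsub : T ⊆ Set.range s := fun a ha =>
      ⟨⟨p a, hT.mapsTo ha⟩, (hTs ⟨p a, hT.mapsTo ha⟩ ⟨(a, ⟨(_, T), hT⟩), ha⟩ rfl rfl).symm⟩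
    have himage : p '' T = p '' Set.range s := hT.image_eq.trans (bijOn_range hs).image_eq.symm
    exact Subtype.ext (Prod.ext rfl
      (((bijOn_range hs).injOn.image_eq_image_iff hsub subset_rfl).mp himage))

theorem isCartesian_fold {A X : FinGSet G} (f : A →[G] X) :
    IsCartesian ((sumMap f (MulActionHom.id G)).comp (sumMap (MulActionHom.id G) f))
      (sumElim (MulActionHom.id G) (MulActionHom.id G))
      (sumElim (MulActionHom.id G) (MulActionHom.id G)) f := by
  refine ⟨?_, ?_⟩
  · rintro (a | a) <;> rfl
  · rintro (_ | _) a rfl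
    · refine ⟨Sum.inl a, ⟨rfl, rfl⟩, ?_⟩
      rintro (b | b) ⟨h, rfl⟩
      · rfl
      · cases h
    · refine ⟨Sum.inr a, ⟨rfl, rfl⟩, ?_⟩
      rintro (b | b) ⟨h, rfl⟩
      · cases h
      · rfl

/- A section of `f ⊔ id` over a fibre of the fold map `X ⊔ X → X` is a point of the fibre of `f`,
so this distributive law is the expansion of `(tr f a) * x`. -/
theorem isExponential_fold {A X : FinGSet G} (f : A →[G] X) :
    IsExponential (sumMap f (MulActionHom.id G)) (sumElim (MulActionHom.id G) (MulActionHom.id G))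
      (sumMap (MulActionHom.id G) f) (sumElim (MulActionHom.id G) (MulActionHom.id G)) f := by
  refine ⟨isCartesian_fold f, fun x s hs => ?_⟩
  obtain ⟨a, ha⟩ : ∃ a, s ⟨Sum.inl x, rfl⟩ = Sum.inl a := by
    have h := hs ⟨Sum.inl x, rfl⟩
    rcases hs' : s ⟨Sum.inl x, rfl⟩ with a | b
    · exact ⟨a, rfl⟩
    · rw [hs'] at h; cases h
  have hfa : f a = x := by
    have h := hs ⟨Sum.inl x, rfl⟩
    rw [ha] at h
    exact Sum.inl.inj h
  have hx : s ⟨Sum.inr x, rfl⟩ = Sum.inr x := by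
    have h := hs ⟨Sum.inr x, rfl⟩
    rcases hs' : s ⟨Sum.inr x, rfl⟩ with b | x'
    · rw [hs'] at h; cases h
    · rw [hs'] at h; exact congrArg Sum.inr (Sum.inr.inj h)
  subst hfa
  refine ⟨a, ⟨rfl, ?_⟩, ?_⟩
  · rintro ⟨_, hy⟩ (w | w) rfl rfl
    exacts [ha.symm, hx.symm]
  · rintro a' ⟨ha', h⟩
    exact Sum.inl.inj ((h ⟨Sum.inl (f a), rfl⟩ (Sum.inl a') rfl (congrArg Sum.inl ha')).trans ha)
/-! ### Orbits -/

section Orbits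

variable [Finite G]

instance (K : Subgroup G) : MulAction.IsPretransitive G (orbit K) :=
  inferInstanceAs (MulAction.IsPretransitive G (G ⧸ K))

/-- The base point of an orbit. -/
def pt (K : Subgroup G) : orbit K := ((1 : G) : G ⧸ K)

instance (K : Subgroup G) : Nonempty (orbit K) := ⟨pt K⟩

instance : Subsingleton (orbit (⊤ : Subgroup G)) := QuotientGroup.subsingleton_quotient_top

theorem smul_pt_eq_iff {K : Subgroup G} (a b : G) : a • pt K = b • pt K ↔ a⁻¹ * b ∈ K := by
  have h : ((a * 1 : G) : G ⧸ K) = ((b * 1 : G) : G ⧸ K) ↔ a⁻¹ * b ∈ K := by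
    rw [mul_one, mul_one, QuotientGroup.eq]
  exact h

/-- The map out of an orbit given by the image `x` of its base point. -/
def orbitTo (K : Subgroup G) {X : FinGSet G} (x : X) (h : K ≤ MulAction.stabilizer G x) :
    orbit K →[G] X where
  toFun := Quotient.lift (fun g : G => g • x) fun a b hab => by
    have hx : (a⁻¹ * b) • x = x := h (QuotientGroup.leftRel_apply.mp hab)
    rw [mul_smul, inv_smul_eq_iff] at hx
    exact hx.symm
  map_smul' a y := QuotientGroup.induction_on y fun z => mul_smul a z x

@[simp]
theorem orbitTo_pt (K : Subgroup G) {X : FinGSet G} (x : X) (h : K ≤ MulAction.stabilizer G x) :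
    orbitTo K x h (pt K) = x := one_smul G x

theorem orbit_hom_ext {K : Subgroup G} {X : FinGSet G} {f g : orbit K →[G] X} (x : orbit K)
    (h : f x = g x) : f = g := by
  ext y
  obtain ⟨a, rfl⟩ := MulAction.exists_smul_eq G x y
  rw [map_smul, map_smul, h]

theorem orbit_hom_surjective {X : FinGSet G} {K : Subgroup G} [hX : Nonempty X]
    (f : X →[G] orbit K) : Function.Surjective f := fun y => by
  obtain ⟨x⟩ := hX
  obtain ⟨g, hg⟩ := MulAction.exists_smul_eq G (f x) y
  exact ⟨g • x, by rw [map_smul, hg]⟩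

/-- The inclusion of the orbit of a point. -/
def orbitIncl {X : FinGSet G} (x : X) : orbit (MulAction.stabilizer G x) →[G] X :=
  orbitTo _ x le_rfl

theorem orbitIncl_injective {X : FinGSet G} (x : X) : Function.Injective (orbitIncl x) := by
  intro y z h
  obtain ⟨a, rfl⟩ := MulAction.exists_smul_eq G (pt _) y
  obtain ⟨b, rfl⟩ := MulAction.exists_smul_eq G (pt _) z
  rw [map_smul, map_smul, orbitIncl, orbitTo_pt] at h
  rw [smul_pt_eq_iff, MulAction.mem_stabilizer_iff, mul_smul, ← h, inv_smul_smul]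

theorem orbit_induction {C : FinGSet G → Prop} (h_empty : ∀ X : FinGSet G, IsEmpty X → C X)
    (h_orbit : ∀ (K : Subgroup G) (Y Z : FinGSet G) (i : orbit K →[G] Z) (j : Y →[G] Z),
      IsDisjointUnion i j → C Y → C Z) (X : FinGSet G) : C X := by
  induction hn : Nat.card X using Nat.strong_induction_on generalizing X with
  | _ n ih =>
    rcases isEmpty_or_nonempty X with hX | ⟨⟨x⟩⟩
    · exact h_empty X hX
    · refine h_orbit _ _ _ (orbitIncl x) _ (isDisjointUnion_compl _ (orbitIncl_injective x))
        (ih _ ?_ _ rfl)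
      rw [← hn]
      exact Finite.card_subtype_lt (x := x) fun hx => hx (pt _) (orbitTo_pt _ _ _)

/-- The map out of the free orbit given by the image `x` of its base point. -/
def free {X : FinGSet G} (x : X) : orbit (⊥ : Subgroup G) →[G] X := orbitTo ⊥ x bot_le

@[simp]
theorem free_pt {X : FinGSet G} (x : X) : free x (pt ⊥) = x := orbitTo_pt _ _ _

theorem eq_free {X : FinGSet G} (f : orbit (⊥ : Subgroup G) →[G] X) : f = free (f (pt ⊥)) :=
  orbit_hom_ext (pt ⊥) (free_pt _).symm

theorem comp_free {X Y : FinGSet G} (f : X →[G] Y) (x : X) : f.comp (free x) = free (f x) := by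
  rw [eq_free (f.comp (free x)), MulActionHom.comp_apply, free_pt]

theorem exists_free_lift {X : FinGSet G} [Nonempty X] {L : Subgroup G} (u : X →[G] orbit L)
    (v : orbit (⊥ : Subgroup G) →[G] orbit L) :
    ∃ w : orbit (⊥ : Subgroup G) →[G] X, u.comp w = v := by
  obtain ⟨x, hx⟩ := orbit_hom_surjective u (v (pt ⊥))
  exact ⟨free x, by rw [comp_free, hx, ← eq_free]⟩

theorem bijective_of_orbit_to_free {K : Subgroup G} (f : orbit K →[G] orbit (⊥ : Subgroup G)) :
    Function.Bijective f := by
  refine ⟨fun x y h => ?_, orbit_hom_surjective f⟩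
  obtain ⟨a, rfl⟩ := MulAction.exists_smul_eq G x y
  obtain ⟨b, hb⟩ := MulAction.exists_smul_eq G (pt ⊥) (f x)
  rw [map_smul, ← hb, ← mul_smul, smul_pt_eq_iff, Subgroup.mem_bot, inv_mul_eq_one,
    right_eq_mul] at h
  rw [h, one_smul]

theorem rightMul_eq_free (g : G) : rightMul g = free (g • pt (⊥ : Subgroup G)) := by
  have h : rightMul g (pt ⊥) = g • pt ⊥ :=
    congrArg (QuotientGroup.mk (s := ⊥)) ((one_mul g).trans (mul_one g).symm)
  rw [eq_free (rightMul g), h]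

theorem comp_rightMul {X : FinGSet G} (f : orbit (⊥ : Subgroup G) →[G] X) (g : G) :
    f.comp (rightMul g) = free (g • f (pt ⊥)) := by
  rw [rightMul_eq_free, comp_free, map_smul]

theorem rightMul_one : rightMul (1 : G) = MulActionHom.id G := by
  rw [rightMul_eq_free, one_smul, eq_free (MulActionHom.id G), MulActionHom.id_apply]

theorem rightMul_mul (g h : G) : rightMul (g * h) = (rightMul h).comp (rightMul g) := by
  rw [comp_rightMul, rightMul_eq_free, rightMul_eq_free, free_pt, mul_smul]

theorem exists_eq_rightMul (f : orbit (⊥ : Subgroup G) →[G] orbit (⊥ : Subgroup G)) :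
    ∃ g, f = rightMul g := by
  obtain ⟨g, hg⟩ := MulAction.exists_smul_eq G (pt ⊥) (f (pt ⊥))
  exact ⟨g, by rw [rightMul_eq_free, hg, ← eq_free]⟩

theorem free_comp_rightMul_eq_iff (H : Subgroup G) (a b : G) :
    (free (pt H)).comp (rightMul a) = (free (pt H)).comp (rightMul b) ↔ a⁻¹ * b ∈ H := by
  rw [comp_rightMul, comp_rightMul, free_pt, ← smul_pt_eq_iff]
  exact ⟨fun h => by rw [← free_pt (a • pt H), h, free_pt], congrArg free⟩

/-- The map to the one-point `G`-set `G / G`. -/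
def toPoint (X : FinGSet G) : X →[G] orbit (⊤ : Subgroup G) where
  toFun _ := pt ⊤
  map_smul' _ _ := Subsingleton.elim _ _

theorem hom_point_ext {X : FinGSet G} (f g : X →[G] orbit (⊤ : Subgroup G)) : f = g :=
  MulActionHom.ext fun _ => Subsingleton.elim _ _

end Orbits

/-! ### Induction of finite `G`-sets -/

section Induction

/-- The element of `H` by which `g` moves from the chosen representative of the coset `c` to the
one of `g • c`. It is the cocycle in the action of `G` on induced `G`-sets. -/
noncomputable def transition (H : Subgroup G) (g : G) (c : G ⧸ H) : H :=
  ⟨(g • c).out⁻¹ * (g * c.out), by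
    rw [← QuotientGroup.eq, QuotientGroup.out_eq', ← smul_eq_mul, MulAction.Quotient.coe_smul_out]⟩

theorem coe_transition (H : Subgroup G) (g : G) (c : G ⧸ H) :
    (transition H g c : G) = (g • c).out⁻¹ * (g * c.out) := rfl

theorem transition_one (H : Subgroup G) (c : G ⧸ H) : transition H 1 c = 1 :=
  Subtype.ext (by rw [coe_transition, one_smul, one_mul, inv_mul_cancel, Subgroup.coe_one])

theorem transition_mul (H : Subgroup G) (a b : G) (c : G ⧸ H) :
    transition H (a * b) c = transition H a (b • c) * transition H b c :=
  Subtype.ext (by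
    rw [Subgroup.coe_mul, coe_transition, coe_transition, coe_transition, mul_smul]
    group)

/-- The chosen representative of the trivial coset. -/
noncomputable def baseRep (H : Subgroup G) : H :=
  ⟨((1 : G) : G ⧸ H).out, inv_mem_iff.mp (by
    rw [← mul_one (Quotient.out _)⁻¹, ← QuotientGroup.eq, QuotientGroup.out_eq'])⟩

theorem coe_baseRep (H : Subgroup G) : (baseRep H : G) = ((1 : G) : G ⧸ H).out := rfl

theorem coe_smul_coe_one {H : Subgroup G} (h : H) :
    (h : G) • ((1 : G) : G ⧸ H) = ((1 : G) : G ⧸ H) := by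
  rw [MulAction.Quotient.smul_coe, QuotientGroup.eq, smul_eq_mul, mul_one, mul_one]
  exact inv_mem h.2

theorem transition_coe_one {H : Subgroup G} (h : H) :
    transition H (h : G) ((1 : G) : G ⧸ H) = (baseRep H)⁻¹ * (h * baseRep H) :=
  Subtype.ext (by
    rw [coe_transition, coe_smul_coe_one, ← coe_baseRep, Subgroup.coe_mul, Subgroup.coe_inv,
      Subgroup.coe_mul])

/-- A point of the underlying `H`-set of a `G`-set, regarded as a point of the `G`-set. -/
def ofRestrict {H : Subgroup G} {X : FinGSet G} (x : restrict H X) : X := x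

theorem ofRestrict_smul {H : Subgroup G} {X : FinGSet G} (h : H) (x : restrict H X) :
    ofRestrict (h • x) = (h : G) • ofRestrict x := rfl

variable [Finite G]

/-- The induced `G`-set `G ×_H X`. In the model `(G ⧸ H) × X`, which depends on representatives of
the cosets, the constructions on `H`-sets are carried out fibrewise. -/
noncomputable def induce (H : Subgroup G) (X : FinGSet H) : FinGSet G where
  carrier := (G ⧸ H) × X
  action :=
    { smul := fun g z => (g • z.1, transition H g z.1 • z.2)
      one_smul := fun z => Prod.ext (one_smul G z.1)
        ((congrArg (· • z.2) (transition_one H z.1)).trans (one_smul H z.2))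
      mul_smul := fun a b z => Prod.ext (mul_smul a b z.1)
        ((congrArg (· • z.2) (transition_mul H a b z.1)).trans (mul_smul _ _ z.2)) }

variable {H : Subgroup G}

/-- The map of induced `G`-sets given by a map of `H`-sets. -/
noncomputable def induceMap {X Y : FinGSet H} (f : X →[H] Y) : induce H X →[G] induce H Y where
  toFun z := (z.1, f z.2)
  map_smul' g z := Prod.ext rfl (map_smul f (transition H g z.1) z.2)

/-- The projection of an induced `G`-set to `G / H`. -/
noncomputable def induceBase (X : FinGSet H) : induce H X →[G] orbit H where
  toFun z := z.1
  map_smul' _ _ := rfl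

theorem isCartesian_induceMap {P A B C : FinGSet H} {a : P →[H] A} {b : P →[H] B} {f : A →[H] C}
    {g : B →[H] C} (h : IsCartesian a b f g) :
    IsCartesian (induceMap a) (induceMap b) (induceMap f) (induceMap g) := by
  refine ⟨fun w => Prod.ext rfl (h.1 w.2), ?_⟩
  rintro ⟨c, x⟩ ⟨c', y⟩ e
  obtain rfl : c = c' := congrArg Prod.fst e
  obtain ⟨w, ⟨hwx, hwy⟩, hw⟩ := h.2 x y (congrArg Prod.snd e)
  refine ⟨(c, w), ⟨Prod.ext rfl hwx, Prod.ext rfl hwy⟩, ?_⟩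
  rintro ⟨c', w'⟩ ⟨hx', hy'⟩
  obtain rfl : c' = c := congrArg Prod.fst hx'
  exact Prod.ext rfl (hw w' ⟨congrArg Prod.snd hx', congrArg Prod.snd hy'⟩)

theorem isDisjointUnion_induceMap {X Y Z : FinGSet H} {i : X →[H] Z} {j : Y →[H] Z}
    (h : IsDisjointUnion i j) : IsDisjointUnion (induceMap i) (induceMap j) := by
  rw [isDisjointUnion_iff] at h ⊢
  obtain ⟨⟨hi, hj, hij⟩, hsurj⟩ := h
  refine ⟨⟨fun x y e => Prod.ext (congrArg Prod.fst e :) (hi (congrArg Prod.snd e)),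
    fun x y e => Prod.ext (congrArg Prod.fst e :) (hj (congrArg Prod.snd e)),
    fun x y e => hij _ _ (congrArg Prod.snd e)⟩, ?_⟩
  rintro ⟨c, z⟩
  obtain ⟨x, rfl⟩ | ⟨y, rfl⟩ := hsurj z
  · exact Or.inl ⟨(c, x), rfl⟩
  · exact Or.inr ⟨(c, y), rfl⟩

theorem isExponential_induceMap {A X Y P Q : FinGSet H} {p : A →[H] X} {f : X →[H] Y}
    {e : P →[H] A} {f' : P →[H] Q} {q : Q →[H] Y} (h : IsExponential p f e f' q) :
    IsExponential (induceMap p) (induceMap f) (induceMap e) (induceMap f') (induceMap q) := by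
  refine ⟨isCartesian_induceMap h.1, ?_⟩
  rintro ⟨c, y⟩ s hs
  have hs_fst : ∀ x, (s x).1 = x.1.1 := fun x => congrArg Prod.fst (hs x)
  have hs_snd : ∀ x, p (s x).2 = x.1.2 := fun x => congrArg Prod.snd (hs x)
  obtain ⟨z, ⟨hqz, hzs⟩, hz⟩ := h.2 y
    (fun x => (s ⟨(c, x.1), Prod.ext rfl x.2⟩).2) (fun x => hs_snd _)
  refine ⟨(c, z), ⟨Prod.ext rfl hqz, ?_⟩, ?_⟩
  · rintro ⟨⟨c', x⟩, hx⟩ ⟨c'', w⟩ hw hwx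
    obtain rfl : c' = c := congrArg Prod.fst hx
    obtain rfl : c'' = c' := congrArg Prod.fst hw
    exact Prod.ext (hs_fst ⟨(_, x), hx⟩).symm
      (hzs ⟨x, congrArg Prod.snd hx⟩ w (congrArg Prod.snd hw) (congrArg Prod.snd hwx))
  · rintro ⟨c', z'⟩ ⟨hqz', hzs'⟩
    obtain rfl : c' = c := congrArg Prod.fst hqz'
    refine Prod.ext rfl (hz z' ⟨congrArg Prod.snd hqz', fun x w hw hwx => ?_⟩)
    exact congrArg Prod.snd (hzs' ⟨(c', x.1), Prod.ext rfl x.2⟩ (c', w) (Prod.ext rfl hw)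
      (Prod.ext rfl hwx))

/-- The unit of the adjunction between induction and restriction. -/
noncomputable def induceUnit (X : FinGSet H) : X →[H] restrict H (induce H X) where
  toFun x := (((1 : G) : G ⧸ H), (baseRep H)⁻¹ • x)
  map_smul' h x := Prod.ext (coe_smul_coe_one h).symm (by
    have hx : (baseRep H)⁻¹ • h • x =
        transition H (h : G) ((1 : G) : G ⧸ H) • (baseRep H)⁻¹ • x := by
      rw [transition_coe_one, mul_smul, mul_smul, smul_inv_smul]
    exact hx)

theorem induceUnit_injective (X : FinGSet H) : Function.Injective (induceUnit X) :=
  fun _ _ h => smul_left_cancel _ (congrArg Prod.snd h)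

theorem exists_induceUnit_eq {X : FinGSet H} (x : X) :
    ∃ y, induceUnit X y = (((1 : G) : G ⧸ H), x) :=
  ⟨baseRep H • x, Prod.ext rfl (inv_smul_smul (baseRep H) x)⟩

theorem exists_smul_induceUnit_eq {X : FinGSet H} (z : induce H X) :
    ∃ (g : G) (x : X), g • ofRestrict (induceUnit X x) = z := by
  obtain ⟨g, hg⟩ := MulAction.exists_smul_eq G (induceBase X z) (pt H)
  obtain ⟨x, hx⟩ := exists_induceUnit_eq (g • z).2
  exact ⟨g⁻¹, x, inv_smul_eq_iff.mpr (hx.trans (Prod.ext hg.symm rfl))⟩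

theorem isCartesian_induceUnit {X Y : FinGSet H} (f : X →[H] Y) :
    IsCartesian (induceUnit X) f (restrictMap H (induceMap f)) (induceUnit Y) := by
  refine ⟨fun x => Prod.ext rfl (map_smul f _ x), ?_⟩
  rintro ⟨c, x⟩ y h
  obtain rfl : c = ((1 : G) : G ⧸ H) := congrArg Prod.fst h
  obtain ⟨w, hw⟩ := exists_induceUnit_eq x
  refine ⟨w, ⟨hw, induceUnit_injective Y ?_⟩, fun w' hw' =>
    induceUnit_injective X (hw'.1.trans hw.symm)⟩
  rw [← h, ← hw]
  exact Prod.ext rfl (map_smul f _ w).symm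

/-- The map out of an induced `G`-set that corresponds to a map of `H`-sets. -/
noncomputable def induceLift {X : FinGSet H} {Y : FinGSet G} (f : X →[H] restrict H Y) :
    induce H X →[G] Y where
  toFun z := z.1.out • ofRestrict (f z.2)
  map_smul' g z := by
    have h : (g • z.1).out • ofRestrict (f (transition H g z.1 • z.2)) =
        g • z.1.out • ofRestrict (f z.2) := by
      rw [map_smul, ofRestrict_smul, coe_transition, mul_smul, smul_inv_smul, mul_smul]
    exact h

theorem induceLift_comp_induceUnit {X : FinGSet H} {Y : FinGSet G} (f : X →[H] restrict H Y) :
    (restrictMap H (induceLift f)).comp (induceUnit X) = f := by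
  ext x
  have h : (baseRep H : G) • ofRestrict (f ((baseRep H)⁻¹ • x)) = ofRestrict (f x) := by
    rw [← ofRestrict_smul, ← map_smul, smul_inv_smul]
  exact h

/-- The counit of the adjunction between induction and restriction. -/
noncomputable def induceCounit (H : Subgroup G) (X : FinGSet G) : induce H (restrict H X) →[G] X :=
  induceLift (MulActionHom.id H)

theorem induceCounit_apply {X : FinGSet G} (c : G ⧸ H) (x : restrict H X) :
    induceCounit H X (c, x) = c.out • ofRestrict x := rfl

theorem isCartesian_induceCounit {X Y : FinGSet G} (f : X →[G] Y) :
    IsCartesian (induceCounit H X) (induceMap (restrictMap H f)) f (induceCounit H Y) := by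
  refine ⟨fun z => map_smul f _ _, ?_⟩
  rintro x ⟨c, y⟩ h
  have hy : f (c.out⁻¹ • x) = ofRestrict y := by
    rw [map_smul, h, induceCounit_apply, inv_smul_smul]
  refine ⟨(c, c.out⁻¹ • x), ⟨smul_inv_smul c.out x, Prod.ext rfl hy⟩, ?_⟩
  rintro ⟨c', z⟩ ⟨rfl, hz⟩
  obtain rfl : c' = c := congrArg Prod.fst hz
  exact Prod.ext rfl (inv_smul_smul c'.out (ofRestrict z)).symm

theorem isCartesian_induceBase (H : Subgroup G) (X : FinGSet G) :
    IsCartesian (induceBase (restrict H X)) (induceCounit H X) (toPoint _) (toPoint X) := by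
  refine ⟨fun w => Subsingleton.elim _ _, fun (c : G ⧸ H) x _ => ?_⟩
  refine ⟨(c, c.out⁻¹ • x), ⟨rfl, smul_inv_smul c.out x⟩, ?_⟩
  rintro ⟨c', z⟩ ⟨rfl, rfl⟩
  exact Prod.ext rfl (inv_smul_smul c'.out (ofRestrict z)).symm

variable (H) in
/-- The isomorphism of the free `G`-orbit with the `G`-set induced from the free `H`-orbit. -/
noncomputable def freeToInduce : orbit (⊥ : Subgroup G) →[G] induce H (orbit (⊥ : Subgroup H)) :=
  free (ofRestrict (induceUnit (orbit ⊥) (pt ⊥)))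

theorem smul_freeToInduce_pt (h : H) : (h : G) • freeToInduce H (pt ⊥) =
    ofRestrict (induceUnit (orbit ⊥) (h • pt (⊥ : Subgroup H))) := by
  rw [freeToInduce, free_pt, map_smul, ofRestrict_smul]

theorem induceBase_comp_freeToInduce :
    (induceBase (orbit (⊥ : Subgroup H))).comp (freeToInduce H) = free (pt H) :=
  comp_free _ _

variable (H) in
theorem freeToInduce_bijective : Function.Bijective (freeToInduce H) := by
  refine ⟨?_, fun z => ?_⟩
  · let retraction : induce H (orbit (⊥ : Subgroup H)) →[G] orbit (⊥ : Subgroup G) :=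
      induceLift (free (X := restrict H (orbit ⊥)) (pt (⊥ : Subgroup G)))
    have h := bijective_of_orbit_to_free (retraction.comp (freeToInduce H))
    exact fun x y e => h.1 (congrArg retraction e)
  · obtain ⟨g, x, rfl⟩ := exists_smul_induceUnit_eq z
    obtain ⟨h, rfl⟩ := MulAction.exists_smul_eq H (pt ⊥) x
    exact ⟨(g * h) • pt ⊥, by rw [map_smul, mul_smul, smul_freeToInduce_pt]⟩

theorem induceMap_rightMul_comp_freeToInduce (h : H) :
    (induceMap (rightMul h)).comp (freeToInduce H) = (freeToInduce H).comp (rightMul (h : G)) := by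
  rw [comp_rightMul, smul_freeToInduce_pt, freeToInduce, comp_free, rightMul_eq_free]
  refine congrArg free (((isCartesian_induceUnit (free (h • pt (⊥ : Subgroup H)))).1 _).trans ?_)
  rw [free_pt]
  rfl

end Induction

end FinGSet

namespace TambaraFunctor

open FinGSet

variable {G : Type u} [Group G]

/-! ### Formal consequences of the axioms -/

section Formal

variable (R : TambaraFunctor.{u, v} G)

theorem res_nm_of_injective {X Y : FinGSet G} (f : X →[G] Y) (hf : Function.Injective f)
    (x : R.obj X) : R.res f (R.nm f x) = x := by
  rw [R.res_nm _ _ _ _ (isCartesian_of_injective f hf), R.res_id, R.nm_id]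

theorem res_tr_of_injective {X Y : FinGSet G} (f : X →[G] Y) (hf : Function.Injective f)
    (x : R.obj X) : R.res f (R.tr f x) = x := by
  rw [R.res_tr _ _ _ _ (isCartesian_of_injective f hf), R.res_id, R.tr_id]

theorem nm_res_of_bijective {X Y : FinGSet G} (f : X →[G] Y) (hf : Function.Bijective f)
    (y : R.obj Y) : R.nm f (R.res f y) = y := by
  rw [← R.res_nm _ _ _ _ (isCartesian_of_bijective f hf), R.res_id, R.nm_id]

theorem nm_comp_res_of_bijective {X Y Z : FinGSet G} (g : Y →[G] Z) (f : X →[G] Y)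
    (hf : Function.Bijective f) (y : R.obj Y) : R.nm (g.comp f) (R.res f y) = R.nm g y := by
  rw [R.nm_comp, R.nm_res_of_bijective f hf]

theorem res_injective_of_bijective {X Y : FinGSet G} (f : X →[G] Y) (hf : Function.Bijective f) :
    Function.Injective (R.res f) :=
  Function.LeftInverse.injective (R.nm_res_of_bijective f hf)

theorem res_tr_of_disjoint {X Y Z : FinGSet G} (i : X →[G] Z) (j : Y →[G] Z)
    (h : ∀ x y, i x ≠ j y) (x : R.obj X) : R.res j (R.tr i x) = 0 := by
  have := R.subsingleton_of_isEmpty (empty G) inferInstance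
  rw [R.res_tr _ _ _ _ (isCartesian_empty i j h), Subsingleton.elim (R.res (emptyMap X) x) 0,
    map_zero]

theorem res_nm_of_disjoint {X Y Z : FinGSet G} (i : X →[G] Z) (j : Y →[G] Z)
    (h : ∀ x y, i x ≠ j y) (x : R.obj X) : R.res j (R.nm i x) = 1 := by
  have := R.subsingleton_of_isEmpty (empty G) inferInstance
  rw [R.res_nm _ _ _ _ (isCartesian_empty i j h), Subsingleton.elim (R.res (emptyMap X) x) 1,
    map_one]

variable {R}

theorem ext_of_isDisjointUnion {X Y Z : FinGSet G} {i : X →[G] Z} {j : Y →[G] Z}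
    (h : IsDisjointUnion i j) {a b : R.obj Z} (hi : R.res i a = R.res i b)
    (hj : R.res j a = R.res j b) : a = b :=
  (R.bijective_of_isDisjointUnion i j h).1 (Prod.ext hi hj)

theorem nm_eq_mul {X Y Z W : FinGSet G} {i : X →[G] Z} {j : Y →[G] Z}
    (h : IsDisjointUnion i j) (f : Z →[G] W) (z : R.obj Z) :
    R.nm f z = R.nm (f.comp i) (R.res i z) * R.nm (f.comp j) (R.res j z) := by
  obtain ⟨⟨hi, hj, hij⟩, -⟩ := (isDisjointUnion_iff i j).mp h
  rw [R.nm_comp, R.nm_comp, ← map_mul]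
  refine congrArg (R.nm f) (ext_of_isDisjointUnion h ?_ ?_)
  · rw [map_mul, R.res_nm_of_injective i hi, R.res_nm_of_disjoint j i fun y x => (hij x y).symm,
      mul_one]
  · rw [map_mul, R.res_nm_of_injective j hj, R.res_nm_of_disjoint i j hij, one_mul]

theorem tr_eq_add {X Y Z W : FinGSet G} {i : X →[G] Z} {j : Y →[G] Z}
    (h : IsDisjointUnion i j) (f : Z →[G] W) (z : R.obj Z) :
    R.tr f z = R.tr (f.comp i) (R.res i z) + R.tr (f.comp j) (R.res j z) := by
  obtain ⟨⟨hi, hj, hij⟩, -⟩ := (isDisjointUnion_iff i j).mp h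
  rw [R.tr_comp, R.tr_comp, ← map_add]
  refine congrArg (R.tr f) (ext_of_isDisjointUnion h ?_ ?_)
  · rw [map_add, R.res_tr_of_injective i hi, R.res_tr_of_disjoint j i fun y x => (hij x y).symm,
      add_zero]
  · rw [map_add, R.res_tr_of_injective j hj, R.res_tr_of_disjoint i j hij, zero_add]

variable (R)

theorem nm_fold {X : FinGSet G} (z : R.obj (FinGSet.sum X X)) :
    R.nm (sumElim (MulActionHom.id G) (MulActionHom.id G)) z =
      R.res (inl X X) z * R.res (inr X X) z := by
  rw [nm_eq_mul (isDisjointUnion_sum X X)]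
  exact congrArg₂ (· * ·) (R.nm_id _) (R.nm_id _)

theorem tr_mul {A X : FinGSet G} (f : A →[G] X) (a : R.obj A) (x : R.obj X) :
    R.tr f a * x = R.tr f (a * R.res f x) := by
  obtain ⟨z, hz⟩ := (R.bijective_of_isDisjointUnion _ _ (isDisjointUnion_sum A X)).2 (a, x)
  obtain ⟨ha, hx⟩ : R.res (inl A X) z = a ∧ R.res (inr A X) z = x := Prod.mk.inj hz
  have h := R.nm_tr _ _ _ _ _ (isExponential_fold f) z
  rw [nm_fold, nm_fold, R.res_tr _ _ _ _ (isCartesian_inl_sumMap f _),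
    R.res_tr _ _ _ _ (isCartesian_inr_sumMap f _), ha, hx, R.tr_id, ← R.res_comp,
    ← R.res_comp] at h
  rw [h, ← ha, ← hx, ← R.res_comp]
  rfl

theorem mul_tr {A X : FinGSet G} (f : A →[G] X) (a : R.obj A) (x : R.obj X) :
    x * R.tr f a = R.tr f (R.res f x * a) := by
  rw [mul_comm, tr_mul, mul_comm]

theorem nm_dvd_nm {X Z W : FinGSet G} (i : X →[G] Z) (hi : Function.Injective i) (f : Z →[G] W)
    (z : R.obj Z) : R.nm (f.comp i) (R.res i z) ∣ R.nm f z := by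
  rw [nm_eq_mul (isDisjointUnion_compl i hi)]
  exact dvd_mul_right _ _

theorem nm_dvd_res_nm {T A B C : FinGSet G} (f : A →[G] C) (g : B →[G] C) (a : T →[G] A)
    (b : T →[G] B) (h : ∀ t, f (a t) = g (b t)) (hi : ∀ s t, a s = a t → b s = b t → s = t)
    (x : R.obj A) : R.nm b (R.res a x) ∣ R.res g (R.nm f x) := by
  have hinj : Function.Injective (pullbackLift f g a b h) := fun s t e =>
    hi s t (congrArg (pullbackFst f g) e) (congrArg (pullbackSnd f g) e)
  have hdvd := R.nm_dvd_nm _ hinj (pullbackSnd f g) (R.res (pullbackFst f g) x)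
  rw [← R.res_comp] at hdvd
  rwa [R.res_nm _ _ _ _ (isCartesian_pullback f g)]

end Formal

section Orbits

variable [Finite G] {R : TambaraFunctor.{u, v} G}

theorem ext_orbit {X : FinGSet G} {a b : R.obj X}
    (h : ∀ (K : Subgroup G) (f : orbit K →[G] X), R.res f a = R.res f b) : a = b := by
  induction X using orbit_induction with
  | h_empty X hX => exact (R.subsingleton_of_isEmpty X hX).elim a b
  | h_orbit K Y Z i j hij ih =>
    refine ext_of_isDisjointUnion hij (h K i) (ih fun L f => ?_)
    rw [← R.res_comp, ← R.res_comp, h]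

theorem mul_nm_eq_self {X Y : FinGSet G} (f : X →[G] Y) (c : R.obj Y) (x : R.obj X)
    (h : ∀ (K : Subgroup G) (k : orbit K →[G] X), c * R.nm (f.comp k) (R.res k x) = c) :
    c * R.nm f x = c := by
  induction X using orbit_induction with
  | h_empty X hX =>
    have := R.subsingleton_of_isEmpty X hX
    rw [Subsingleton.elim x 1, map_one, mul_one]
  | h_orbit K X Z i j hij ih =>
    rw [nm_eq_mul hij, ← mul_assoc, h, ih]
    intro L k
    rw [← R.res_comp]
    exact h L (j.comp k)

theorem nm_eq_of_forall_orbit {X Y : FinGSet G} [hX : Nonempty X] (f : X →[G] Y) {c : R.obj Y}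
    (hc : IsIdempotentElem c) (x : R.obj X)
    (h : ∀ (K : Subgroup G) (k : orbit K →[G] X), R.nm (f.comp k) (R.res k x) = c) :
    R.nm f x = c := by
  obtain ⟨p⟩ := hX
  have hdvd : c ∣ R.nm f x := h _ (orbitIncl p) ▸ R.nm_dvd_nm _ (orbitIncl_injective p) f x
  obtain ⟨y, hy⟩ := hdvd
  rw [← mul_nm_eq_self f c x fun K k => (congrArg (c * ·) (h K k)).trans hc, hy, ← mul_assoc, hc]

instance (R : TambaraFunctor.{u, v} G) : MulSemiringAction G (R.obj (orbit ⊥)) where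
  smul g := R.conjAct g
  one_smul x := by
    have h : R.res (rightMul 1) x = x := by rw [rightMul_one, R.res_id]
    exact h
  mul_smul g h x := by
    have h : R.res (rightMul (g * h)) x = R.res (rightMul g) (R.res (rightMul h) x) := by
      rw [rightMul_mul, R.res_comp]
    exact h
  smul_zero g := map_zero (R.conjAct g)
  smul_add g := map_add (R.conjAct g)
  smul_one g := map_one (R.conjAct g)
  smul_mul g := map_mul (R.conjAct g)

theorem smul_eq_res_rightMul (g : G) (x : R.obj (orbit ⊥)) : g • x = R.res (rightMul g) x := rfl

end Orbits

/-! ### Tambara ideals at arbitrary finite `G`-sets -/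

namespace TambaraIdeal

variable [Finite G] {R : TambaraFunctor.{u, v} G}

theorem mem_span {s : ∀ K : Subgroup G, Set (R.obj (orbit K))} {K : Subgroup G}
    {x : R.obj (orbit K)} : x ∈ (span s).ideal K ↔
      ∀ I : TambaraIdeal R, (∀ L, s L ⊆ I.ideal L) → x ∈ I.ideal K := by
  simp only [span, Submodule.mem_iInf]

theorem span_le {s : ∀ K : Subgroup G, Set (R.obj (orbit K))} {P : TambaraIdeal R} :
    span s ≤ P ↔ ∀ K, s K ⊆ P.ideal K :=
  ⟨fun h K _ hx => h K (mem_span.mpr fun _ hI => hI K hx), fun h _ _ hx => mem_span.mp hx P h⟩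

theorem mul_le_iff {I J P : TambaraIdeal R} :
    I * J ≤ P ↔ ∀ K, ∀ a ∈ I.ideal K, ∀ b ∈ J.ideal K, a * b ∈ P.ideal K :=
  span_le.trans ⟨fun h K a ha b hb => h K ⟨a, ha, b, hb, rfl⟩, by
    rintro h K _ ⟨a, ha, b, hb, rfl⟩
    exact h K a ha b hb⟩

theorem mem_bot {K : Subgroup G} {x : R.obj (orbit K)} :
    x ∈ (⊥ : TambaraIdeal R).ideal K ↔ x = 0 := Ideal.mem_bot

/-- The value of a Tambara ideal at an arbitrary finite `G`-set. -/
def extend (I : TambaraIdeal R) (X : FinGSet G) : Ideal (R.obj X) :=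
  ⨅ (K : Subgroup G) (f : orbit K →[G] X), (I.ideal K).comap (R.res f)

theorem mem_extend {I : TambaraIdeal R} {X : FinGSet G} {x : R.obj X} :
    x ∈ I.extend X ↔ ∀ (K : Subgroup G) (f : orbit K →[G] X), R.res f x ∈ I.ideal K := by
  simp only [extend, Submodule.mem_iInf, Ideal.mem_comap]

theorem mem_extend_orbit {I : TambaraIdeal R} {K : Subgroup G} {x : R.obj (orbit K)} :
    x ∈ I.extend (orbit K) ↔ x ∈ I.ideal K :=
  mem_extend.trans ⟨fun h => R.res_id x ▸ h K (MulActionHom.id G), fun h _ f => I.res_mem f h⟩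

theorem res_mem_extend (I : TambaraIdeal R) {X Y : FinGSet G} (f : X →[G] Y) {y : R.obj Y}
    (hy : y ∈ I.extend Y) : R.res f y ∈ I.extend X :=
  mem_extend.mpr fun K g => R.res_comp f g y ▸ mem_extend.mp hy K (f.comp g)

theorem tr_mem_of_mem_extend (I : TambaraIdeal R) {X : FinGSet G} {K : Subgroup G}
    (f : X →[G] orbit K) {x : R.obj X} (hx : x ∈ I.extend X) : R.tr f x ∈ I.ideal K := by
  induction X using orbit_induction with
  | h_empty X hX =>
    have := R.subsingleton_of_isEmpty X hX
    rw [Subsingleton.elim x 0, map_zero]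
    exact zero_mem _
  | h_orbit L X Z i j hij ih =>
    rw [tr_eq_add hij]
    exact add_mem (I.tr_mem _ (mem_extend.mp hx L i)) (ih _ (I.res_mem_extend j hx))

theorem nm_mem_of_mem_extend (I : TambaraIdeal R) {X : FinGSet G} [hX : Nonempty X]
    {K : Subgroup G} (f : X →[G] orbit K) {x : R.obj X} (hx : x ∈ I.extend X) :
    R.nm f x ∈ I.ideal K := by
  obtain ⟨p⟩ := hX
  exact Ideal.mem_of_dvd _ (R.nm_dvd_nm (orbitIncl p) (orbitIncl_injective p) f x)
    (I.nm_mem _ (mem_extend.mp hx _ _))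

theorem tr_mem_extend (I : TambaraIdeal R) {X Y : FinGSet G} (f : X →[G] Y) {x : R.obj X}
    (hx : x ∈ I.extend X) : R.tr f x ∈ I.extend Y := by
  refine mem_extend.mpr fun K g => ?_
  rw [R.res_tr _ _ _ _ (isCartesian_pullback f g)]
  exact I.tr_mem_of_mem_extend _ (I.res_mem_extend _ hx)

theorem nm_mem_extend (I : TambaraIdeal R) {X Y : FinGSet G} (f : X →[G] Y)
    (hf : Function.Surjective f) {x : R.obj X} (hx : x ∈ I.extend X) : R.nm f x ∈ I.extend Y := by
  refine mem_extend.mpr fun K g => ?_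
  obtain ⟨p, hp⟩ := hf (g (pt K))
  have : Nonempty (pullback f g) := ⟨⟨(p, pt K), hp⟩⟩
  rw [R.res_nm _ _ _ _ (isCartesian_pullback f g)]
  exact I.nm_mem_of_mem_extend _ (I.res_mem_extend _ hx)

theorem eq_zero_of_mem_extend {I : TambaraIdeal R} (h : I ≤ ⊥) {X : FinGSet G} {x : R.obj X}
    (hx : x ∈ I.extend X) : x = 0 :=
  ext_orbit fun K f => (h K (mem_extend.mp hx K f)).trans (map_zero _).symm

theorem mul_eq_zero_of_mem_extend {I J : TambaraIdeal R} (h : I * J ≤ ⊥) {X : FinGSet G}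
    {x y : R.obj X} (hx : x ∈ I.extend X) (hy : y ∈ J.extend X) : x * y = 0 := by
  refine ext_orbit fun K f => ?_
  rw [map_mul, map_zero]
  exact mul_le_iff.mp h K _ (mem_extend.mp hx K f) _ (mem_extend.mp hy K f)

end TambaraIdeal

/-! ### Domain-like functors -/

section DomainLike

variable [Finite G]

theorem nontrivial_obj_free (R : TambaraFunctor.{u, v} G) {X : FinGSet G} [Nontrivial (R.obj X)] :
    Nontrivial (R.obj (orbit ⊥)) := by
  by_contra h
  rw [not_nontrivial_iff_subsingleton] at h
  refine one_ne_zero (α := R.obj X) (ext_orbit fun K f => ?_)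
  rw [map_one, map_zero, ← map_one (R.nm (free (pt K))), Subsingleton.elim 1 0, nm_orbit_zero]

theorem isDomainLike_iff (R : TambaraFunctor.{u, v} G) :
    R.IsDomainLike ↔ Nontrivial (R.obj (orbit ⊥)) ∧
      ∀ I J : TambaraIdeal R, I * J ≤ ⊥ → I ≤ ⊥ ∨ J ≤ ⊥ := by
  refine and_congr_left fun _ => ⟨?_, fun _ => ⟨⊥, (bot_ne_top : (⊥ : Ideal _) ≠ ⊤)⟩⟩
  rintro ⟨K, hK⟩
  have : Nontrivial (R.obj (orbit K)) := ⟨1, 0, (Ideal.ne_top_iff_one _).mp hK⟩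
  exact R.nontrivial_obj_free (X := orbit K)

theorem IsDomainLike.of_idealMap {G' : Type u} [Group G'] [Finite G'] {R : TambaraFunctor.{u, v} G}
    {S : TambaraFunctor.{u, v} G'} (h : R.IsDomainLike)
    (h_nontrivial : Nontrivial (R.obj (orbit ⊥)) → Nontrivial (S.obj (orbit ⊥)))
    (φ : TambaraIdeal S → TambaraIdeal R) (h_mul : ∀ I J, I * J ≤ ⊥ → φ I * φ J ≤ ⊥)
    (h_bot : ∀ I, φ I ≤ ⊥ → I ≤ ⊥) : S.IsDomainLike := by
  rw [isDomainLike_iff] at h ⊢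
  exact ⟨h_nontrivial h.1, fun I J hIJ => (h.2 _ _ (h_mul I J hIJ)).imp (h_bot I) (h_bot J)⟩

/-- The inverse of an isomorphism of Tambara functors. -/
def Iso.symm {R S : TambaraFunctor.{u, v} G} (Φ : Iso R S) : Iso S R where
  equiv X := (Φ.equiv X).symm
  map_res f a := by rw [RingEquiv.symm_apply_eq, Φ.map_res, RingEquiv.apply_symm_apply]
  map_tr f a := by rw [RingEquiv.symm_apply_eq, Φ.map_tr, RingEquiv.apply_symm_apply]
  map_nm f a := by rw [RingEquiv.symm_apply_eq, Φ.map_nm, RingEquiv.apply_symm_apply]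

/-- The preimage of a Tambara ideal under an isomorphism of Tambara functors. -/
def TambaraIdeal.comap {R S : TambaraFunctor.{u, v} G} (Φ : Iso R S) (I : TambaraIdeal S) :
    TambaraIdeal R where
  ideal K := (I.ideal K).comap (Φ.equiv (orbit K)).toRingHom
  res_mem f _ ha := (congrArg (· ∈ I.ideal _) (Φ.map_res f _)).mpr (I.res_mem f ha)
  tr_mem f _ ha := (congrArg (· ∈ I.ideal _) (Φ.map_tr f _)).mpr (I.tr_mem f ha)
  nm_mem f _ ha := (congrArg (· ∈ I.ideal _) (Φ.map_nm f _)).mpr (I.nm_mem f ha)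

theorem Iso.isDomainLike {R S : TambaraFunctor.{u, v} G} (Φ : Iso R S) (h : R.IsDomainLike) :
    S.IsDomainLike := by
  refine h.of_idealMap (fun _ => (Φ.equiv _).symm.toEquiv.nontrivial) (TambaraIdeal.comap Φ)
    (fun I J hIJ => TambaraIdeal.mul_le_iff.mpr fun K a ha b hb => ?_) (fun I hI K x hx => ?_)
  · have hab : Φ.equiv _ (a * b) = 0 := by
      rw [map_mul]
      exact TambaraIdeal.mul_le_iff.mp hIJ K _ ha _ hb
    exact (map_eq_zero_iff _ (Φ.equiv _).injective).mp hab
  · have hx' : Φ.equiv _ ((Φ.equiv _).symm x) ∈ I.ideal K := by rwa [RingEquiv.apply_symm_apply]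
    exact (map_eq_zero_iff _ (Φ.equiv _).symm.injective).mp (hI K hx')

theorem Iso.isDomainLike_iff {R S : TambaraFunctor.{u, v} G} (Φ : Iso R S) :
    R.IsDomainLike ↔ S.IsDomainLike := ⟨Φ.isDomainLike, Φ.symm.isDomainLike⟩

end DomainLike

/-! ### Domain-like coinduced functors -/

section Coinduction

variable [Finite G] {H : Subgroup G} {S : TambaraFunctor.{u, v} H}

/-- The Tambara ideal of a coinduced functor that is coinduced from a Tambara ideal. -/
def TambaraIdeal.coind (I : TambaraIdeal S) : TambaraIdeal (TambaraFunctor.coind H S) where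
  ideal K := I.extend (restrict H (orbit K))
  res_mem f _ ha := I.res_mem_extend (restrictMap H f) ha
  tr_mem f _ ha := I.tr_mem_extend (restrictMap H f) ha
  nm_mem f _ ha := I.nm_mem_extend (restrictMap H f) (orbit_hom_surjective f) ha

variable (S) in
/-- The ring homomorphism from the value of `CoInd_H^G S` at `G ×_H X` to `S(X)`. -/
noncomputable def coindInduceHom (X : FinGSet H) : (coind H S).obj (induce H X) →+* S.obj X :=
  S.res (induceUnit X)

theorem coindInduceHom_surjective (X : FinGSet H) : Function.Surjective (coindInduceHom S X) :=
  fun x => ⟨S.tr (induceUnit X) x, S.res_tr_of_injective _ (induceUnit_injective X) x⟩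

theorem res_coindInduceHom {X Y : FinGSet H} (f : X →[H] Y) (y : (coind H S).obj (induce H Y)) :
    S.res f (coindInduceHom S Y y) = coindInduceHom S X ((coind H S).res (induceMap f) y) := by
  have h : (induceUnit Y).comp f = (restrictMap H (induceMap f)).comp (induceUnit X) :=
    MulActionHom.ext fun x => ((isCartesian_induceUnit f).1 x).symm
  exact (S.res_comp _ _ _).symm.trans ((congrArg (S.res · y) h).trans (S.res_comp _ _ _))

theorem tr_coindInduceHom {X Y : FinGSet H} (f : X →[H] Y) (x : (coind H S).obj (induce H X)) :
    S.tr f (coindInduceHom S X x) = coindInduceHom S Y ((coind H S).tr (induceMap f) x) :=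
  (S.res_tr _ _ _ _ (isCartesian_induceUnit f) x).symm

theorem nm_coindInduceHom {X Y : FinGSet H} (f : X →[H] Y) (x : (coind H S).obj (induce H X)) :
    S.nm f (coindInduceHom S X x) = coindInduceHom S Y ((coind H S).nm (induceMap f) x) :=
  (S.res_nm _ _ _ _ (isCartesian_induceUnit f) x).symm

theorem res_eq_coindInduceHom {X : FinGSet H} {Y : FinGSet G} (f : X →[H] restrict H Y)
    (y : (coind H S).obj Y) :
    S.res f y = coindInduceHom S X ((coind H S).res (induceLift f) y) :=
  (congrArg (S.res · y) (induceLift_comp_induceUnit f).symm).trans (S.res_comp _ _ _)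

/-- The Tambara ideal of `S` given by a Tambara ideal of the coinduced functor. -/
noncomputable def TambaraIdeal.ofCoind (I : TambaraIdeal (TambaraFunctor.coind H S)) :
    TambaraIdeal S where
  ideal K := (I.extend (induce H (orbit K))).map (coindInduceHom S (orbit K))
  res_mem f a ha := by
    rw [Ideal.mem_map_iff_of_surjective _ (coindInduceHom_surjective _)] at ha ⊢
    obtain ⟨x, hx, rfl⟩ := ha
    exact ⟨_, I.res_mem_extend (induceMap f) hx, (res_coindInduceHom f x).symm⟩
  tr_mem f a ha := by
    rw [Ideal.mem_map_iff_of_surjective _ (coindInduceHom_surjective _)] at ha ⊢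
    obtain ⟨x, hx, rfl⟩ := ha
    exact ⟨_, I.tr_mem_extend (induceMap f) hx, (tr_coindInduceHom f x).symm⟩
  nm_mem f a ha := by
    rw [Ideal.mem_map_iff_of_surjective _ (coindInduceHom_surjective _)] at ha ⊢
    obtain ⟨x, hx, rfl⟩ := ha
    have hf : Function.Surjective (induceMap f) := Function.surjective_id.prodMap
      (orbit_hom_surjective f)
    exact ⟨_, I.nm_mem_extend (induceMap f) hf hx, (nm_coindInduceHom f x).symm⟩

theorem isDomainLike_of_coind (h : (coind H S).IsDomainLike) : S.IsDomainLike := by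
  refine h.of_idealMap
    (fun (_ : Nontrivial (S.obj (restrict H (orbit (⊥ : Subgroup G))))) =>
      S.nontrivial_obj_free (X := restrict H (orbit ⊥)))
    TambaraIdeal.coind
    (fun I J hIJ => TambaraIdeal.mul_le_iff.mpr fun K a ha b hb =>
      TambaraIdeal.mul_eq_zero_of_mem_extend hIJ ha hb) (fun I hI K x hx => ?_)
  have hx' : S.tr (induceUnit (orbit K)) x ∈ I.coind.extend (induce H (orbit K)) :=
    TambaraIdeal.mem_extend.mpr fun L f => I.res_mem_extend (restrictMap H f)
      (I.tr_mem_extend _ (TambaraIdeal.mem_extend_orbit.mpr hx))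
  rw [TambaraIdeal.mem_bot, ← S.res_tr_of_injective _ (induceUnit_injective _) x]
  exact (congrArg (S.res _) (TambaraIdeal.eq_zero_of_mem_extend hI hx')).trans (map_zero _)

theorem IsDomainLike.coind (h : S.IsDomainLike) : (coind H S).IsDomainLike := by
  refine h.of_idealMap
    (fun _ => (S.res (free (X := restrict H (orbit ⊥)) (pt (⊥ : Subgroup G)))).domain_nontrivial)
    TambaraIdeal.ofCoind (fun I J hIJ => TambaraIdeal.mul_le_iff.mpr fun K a ha b hb => ?_)
    (fun I hI K x hx => ?_)
  · obtain ⟨x, hx, rfl⟩ :=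
      (Ideal.mem_map_iff_of_surjective _ (coindInduceHom_surjective _)).mp ha
    obtain ⟨y, hy, rfl⟩ :=
      (Ideal.mem_map_iff_of_surjective _ (coindInduceHom_surjective _)).mp hb
    rw [← map_mul, TambaraIdeal.mul_eq_zero_of_mem_extend hIJ hx hy, map_zero]
    exact zero_mem _
  · refine ext_orbit (R := S) fun L f => ?_
    have hf : S.res f x ∈ I.ofCoind.ideal L := by
      rw [res_eq_coindInduceHom f x]
      exact Ideal.mem_map_of_mem _
        (I.res_mem_extend (induceLift f) (TambaraIdeal.mem_extend_orbit.mpr hx))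
    exact (hI L hf).trans (map_zero _).symm

theorem isDomainLike_coind_iff : (coind H S).IsDomainLike ↔ S.IsDomainLike :=
  ⟨isDomainLike_of_coind, IsDomainLike.coind⟩

end Coinduction

/-! ### Restriction to a subgroup -/

/-- The restriction of a `G`-Tambara functor to a subgroup `H`, with value `R(G ×_H X)` at `X`. -/
noncomputable def restrictGroup [Finite G] (R : TambaraFunctor.{u, v} G) (H : Subgroup G) :
    TambaraFunctor.{u, v} H where
  obj X := R.obj (induce H X)
  res f := R.res (induceMap f)
  tr f := R.tr (induceMap f)
  nm f := R.nm (induceMap f)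
  res_id := R.res_id
  tr_id := R.tr_id
  nm_id := R.nm_id
  res_comp g f := R.res_comp (induceMap g) (induceMap f)
  tr_comp g f := R.tr_comp (induceMap g) (induceMap f)
  nm_comp g f := R.nm_comp (induceMap g) (induceMap f)
  subsingleton_of_isEmpty X h := R.subsingleton_of_isEmpty (induce H X) ⟨fun z => h.elim z.2⟩
  bijective_of_isDisjointUnion _ _ h :=
    R.bijective_of_isDisjointUnion _ _ (isDisjointUnion_induceMap h)
  res_tr _ _ _ _ h := R.res_tr _ _ _ _ (isCartesian_induceMap h)
  res_nm _ _ _ _ h := R.res_nm _ _ _ _ (isCartesian_induceMap h)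
  nm_tr _ _ _ _ _ h := R.nm_tr _ _ _ _ _ (isExponential_induceMap h)

/-! ### Compatible families of idempotents -/

/-- An idempotent of each value of `R`, preserved by restrictions and by norms along surjections.
Multiplication by such a family cuts out a corner of `R`. -/
structure IdempotentFamily (R : TambaraFunctor.{u, v} G) where
  e : ∀ X : FinGSet G, R.obj X
  isIdempotentElem : ∀ X, IsIdempotentElem (e X)
  res_e : ∀ {X Y : FinGSet G} (f : X →[G] Y), R.res f (e Y) = e X
  nm_e : ∀ {X Y : FinGSet G} (f : X →[G] Y), Function.Surjective f → R.nm f (e X) = e Y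

namespace IdempotentFamily

variable {R : TambaraFunctor.{u, v} G} (E : IdempotentFamily R)

theorem tr_mul_e {X Y : FinGSet G} (f : X →[G] Y) (x : R.obj X) :
    R.tr f x * E.e Y = R.tr f (x * E.e X) := by
  rw [tr_mul, E.res_e]

theorem res_mul_e {X Y : FinGSet G} (f : X →[G] Y) (y : R.obj Y) :
    R.res f y * E.e X = R.res f (y * E.e Y) := by
  rw [map_mul, E.res_e]

theorem mem_corner_iff {X : FinGSet G} {x : R.obj X} :
    x ∈ Subsemigroup.corner (E.e X) ↔ x * E.e X = x := by
  rw [Subsemigroup.mem_corner_iff (E.isIdempotentElem X), mul_comm (E.e X), and_self]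

theorem coe_mul_e {X : FinGSet G} (x : (E.isIdempotentElem X).Corner) : x.1 * E.e X = x.1 :=
  E.mem_corner_iff.mp x.2

/-- Multiplication by the idempotent, as a ring homomorphism onto the corner. -/
def toCorner (X : FinGSet G) : R.obj X →+* (E.isIdempotentElem X).Corner where
  toFun x := ⟨x * E.e X, E.mem_corner_iff.mpr (by rw [mul_assoc, (E.isIdempotentElem X).eq])⟩
  map_one' := Subtype.ext (one_mul _)
  map_mul' x y := Subtype.ext (by
    change x * y * E.e X = x * E.e X * (y * E.e X)
    rw [mul_mul_mul_comm, (E.isIdempotentElem X).eq])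
  map_zero' := Subtype.ext (zero_mul _)
  map_add' x y := Subtype.ext (add_mul x y _)

variable [Finite G]

theorem nm_e_mul_e {X Y : FinGSet G} (f : X →[G] Y) : R.nm f (E.e X) * E.e Y = E.e Y := by
  refine ext_orbit fun K g => ?_
  rw [map_mul, R.res_nm _ _ _ _ (isCartesian_pullback f g), E.res_e, E.res_e, mul_comm]
  refine mul_nm_eq_self _ _ _ fun L k => ?_
  rw [E.res_e, E.nm_e _ (orbit_hom_surjective _)]
  exact E.isIdempotentElem _

theorem nm_mul_e {X Y : FinGSet G} (f : X →[G] Y) (x : R.obj X) :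
    R.nm f (x * E.e X) * E.e Y = R.nm f x * E.e Y := by
  rw [map_mul, mul_assoc, E.nm_e_mul_e]

/-- The Tambara ideal generated by a compatible family of idempotents. -/
def principal : TambaraIdeal R where
  ideal K := Ideal.span {E.e (orbit K)}
  res_mem f a ha := by
    rw [Ideal.mem_span_singleton] at ha ⊢
    exact E.res_e f ▸ map_dvd (R.res f) ha
  tr_mem f a ha := by
    rw [Ideal.mem_span_singleton] at ha ⊢
    obtain ⟨b, rfl⟩ := ha
    exact ⟨R.tr f b, by rw [mul_comm, mul_comm (E.e _), tr_mul_e]⟩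
  nm_mem f a ha := by
    rw [Ideal.mem_span_singleton] at ha ⊢
    exact E.nm_e f (orbit_hom_surjective f) ▸ map_dvd (R.nm f) ha

/-- The annihilator of a compatible family of idempotents. -/
def annihilator : TambaraIdeal R where
  ideal K := (Ideal.span {E.e (orbit K)}).annihilator
  res_mem f a ha := by
    rw [Ideal.span, Submodule.mem_annihilator_span_singleton, smul_eq_mul] at ha ⊢
    rw [res_mul_e, ha, map_zero]
  tr_mem f a ha := by
    rw [Ideal.span, Submodule.mem_annihilator_span_singleton, smul_eq_mul] at ha ⊢
    rw [tr_mul_e, ha, map_zero]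
  nm_mem f a ha := by
    rw [Ideal.span, Submodule.mem_annihilator_span_singleton, smul_eq_mul] at ha ⊢
    rw [← nm_mul_e, ha, nm_orbit_zero, zero_mul]

theorem principal_mul_annihilator_le_bot : E.principal * E.annihilator ≤ ⊥ := by
  refine TambaraIdeal.mul_le_iff.mpr fun K a ha b hb => ?_
  obtain ⟨c, rfl⟩ := Ideal.mem_span_singleton.mp ha
  rw [TambaraIdeal.mem_bot, mul_right_comm, mul_comm (E.e _),
    ← smul_eq_mul b, (Submodule.mem_annihilator_span_singleton _ _).mp hb, zero_mul]

theorem e_eq_zero_or_eq_one (h : R.IsDomainLike) (K : Subgroup G) :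
    E.e (orbit K) = 0 ∨ E.e (orbit K) = 1 := by
  rw [isDomainLike_iff] at h
  refine (h.2 _ _ E.principal_mul_annihilator_le_bot).imp (fun h0 => ?_) fun h0 => ?_
  · exact h0 K (Ideal.mem_span_singleton_self _)
  · refine (sub_eq_zero.mp (h0 K ((Submodule.mem_annihilator_span_singleton _ _).mpr ?_))).symm
    rw [smul_eq_mul, sub_mul, one_mul, (E.isIdempotentElem _).eq, sub_self]

/-- The corner of a Tambara functor at a compatible family of idempotents. -/
def corner : TambaraFunctor.{u, v} G where
  obj X := (E.isIdempotentElem X).Corner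
  res {X Y} f :=
    { toFun y := ⟨R.res f y.1, E.mem_corner_iff.mpr (by rw [res_mul_e, coe_mul_e])⟩
      map_one' := Subtype.ext (E.res_e f)
      map_mul' x y := Subtype.ext (map_mul (R.res f) x.1 y.1)
      map_zero' := Subtype.ext (map_zero (R.res f))
      map_add' x y := Subtype.ext (map_add (R.res f) x.1 y.1) }
  tr {X Y} f :=
    { toFun x := ⟨R.tr f x.1, E.mem_corner_iff.mpr (by rw [tr_mul_e, coe_mul_e])⟩
      map_zero' := Subtype.ext (map_zero (R.tr f))
      map_add' x y := Subtype.ext (map_add (R.tr f) x.1 y.1) }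
  nm {X Y} f :=
    { toFun x := E.toCorner Y (R.nm f x.1)
      map_one' := Subtype.ext (E.nm_e_mul_e f)
      map_mul' x y := (congrArg (E.toCorner Y) (map_mul (R.nm f) x.1 y.1)).trans (map_mul _ _ _) }
  res_id x := Subtype.ext (R.res_id x.1)
  tr_id x := Subtype.ext (R.tr_id x.1)
  nm_id x := Subtype.ext ((congrArg (· * E.e _) (R.nm_id x.1)).trans (E.coe_mul_e x))
  res_comp g f x := Subtype.ext (R.res_comp g f x.1)
  tr_comp g f x := Subtype.ext (R.tr_comp g f x.1)
  nm_comp g f x := Subtype.ext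
    ((congrArg (· * E.e _) (R.nm_comp g f x.1)).trans (E.nm_mul_e g _).symm)
  subsingleton_of_isEmpty X h :=
    have := R.subsingleton_of_isEmpty X h
    ⟨fun x y => Subtype.ext (Subsingleton.elim x.1 y.1)⟩
  bijective_of_isDisjointUnion {X Y Z} i j h := by
    refine ⟨fun z w hzw => Subtype.ext (ext_of_isDisjointUnion h (congrArg (fun p => p.1.1) hzw)
      (congrArg (fun p => p.2.1) hzw)), fun ⟨x, y⟩ => ?_⟩
    obtain ⟨z, hz⟩ := (R.bijective_of_isDisjointUnion i j h).2 (x.1, y.1)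
    obtain ⟨hx, hy⟩ : R.res i z = x.1 ∧ R.res j z = y.1 := Prod.mk.inj hz
    refine ⟨⟨z, E.mem_corner_iff.mpr (ext_of_isDisjointUnion h ?_ ?_)⟩,
      Prod.ext (Subtype.ext hx) (Subtype.ext hy)⟩
    · rw [← res_mul_e, hx, coe_mul_e]
    · rw [← res_mul_e, hy, coe_mul_e]
  res_tr a b f g h x := Subtype.ext (R.res_tr a b f g h x.1)
  res_nm a b f g h x := Subtype.ext
    ((E.res_mul_e g _).symm.trans (congrArg (· * E.e _) (R.res_nm a b f g h x.1)))
  nm_tr p f e f' q h x := Subtype.ext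
    ((congrArg (· * E.e _) (R.nm_tr p f e f' q h x.1)).trans (E.tr_mul_e q _))

end IdempotentFamily

end TambaraFunctor

/-! ### Norms of imprimitivity idempotents -/

namespace TambaraFunctor

open FinGSet

variable {G : Type u} [Group G] [Finite G] (R : TambaraFunctor.{u, v} G)

/-- The norm of an element of `R(G/e)` to `R(G/H)`, along the projection of orbits. -/
def cosetNorm (H : Subgroup G) (d : R.obj (orbit ⊥)) : R.obj (orbit H) := R.nm (free (pt H)) d

/-- The norm of an element of `R(G/e)` to `R(G/H)`, followed by the transfer to `R(G/G)`. For an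
imprimitivity idempotent `d` its restriction to `R(G/e)` is the sum of the translates of `d`. -/
def trCosetNorm (H : Subgroup G) (d : R.obj (orbit ⊥)) : R.obj (orbit (⊤ : Subgroup G)) :=
  R.tr (toPoint (orbit H)) (R.cosetNorm H d)

variable {R}

theorem res_res_toPoint {X Y : FinGSet G} (f : X →[G] Y) (x : R.obj (orbit ⊤)) :
    R.res f (R.res (toPoint Y) x) = R.res (toPoint X) x := by
  rw [← R.res_comp, hom_point_ext ((toPoint Y).comp f) (toPoint X)]

theorem nm_free_pt_res_comp_rightMul {X : FinGSet G} {L : Subgroup G} {l : G} (hl : l ∈ L)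
    (k : orbit ⊥ →[G] X) (x : R.obj X) : R.nm (free (pt L)) (R.res (k.comp (rightMul l)) x) =
      R.nm (free (pt L)) (R.res k x) := by
  have h : (free (pt L)).comp (rightMul l) = free (pt L) := by
    rw [(free_comp_rightMul_eq_iff L l 1).mpr (by rwa [mul_one, inv_mem_iff]), rightMul_one]
    rfl
  conv_lhs => rw [← h, R.res_comp, R.nm_comp_res_of_bijective _ _ (bijective_of_orbit_to_free _)]

/-- Expanding `1 = nm (res (tr x))` with the distributive law gives a transfer all of whose
components are divisible by norms of restrictions of `x`. -/
theorem eq_one_of_forall_mul_nm_res {A : FinGSet G} {x : R.obj A}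
    (hx : R.res (toPoint (orbit ⊥)) (R.tr (toPoint A) x) = 1) {u : R.obj (orbit ⊤)}
    (hu : ∀ (L : Subgroup G) (k : orbit ⊥ →[G] A), R.res (toPoint (orbit L)) u *
      R.nm (free (pt L)) (R.res k x) = R.nm (free (pt L)) (R.res k x)) : u = 1 := by
  let π := toPoint (orbit (⊥ : Subgroup G))
  let p := pullbackSnd (toPoint A) π
  let a := (pullbackFst (toPoint A) π).comp (depProdEvalFst p π)
  have hexp := isExponential_depProd p π
  have h_one : R.tr (depProdBase p π) (R.nm (depProdEvalSnd p π) (R.res a x)) = 1 := by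
    rw [R.res_comp, ← R.nm_tr _ _ _ _ _ hexp, ← R.res_tr _ _ _ _ (isCartesian_pullback _ π), hx,
      map_one]
  rw [← mul_one u, ← h_one, mul_tr]
  refine congrArg _ (ext_orbit fun L k => ?_)
  obtain ⟨w, ⟨-, hw⟩, -⟩ := hexp.1.2 (pt ⊥) (k (pt L)) (Subsingleton.elim _ _)
  have hsq : (depProdEvalSnd p π).comp (free w) = k.comp (free (pt L)) := by
    rw [comp_free, comp_free, hw]
  have hinj := (bijective_of_orbit_to_free ((p.comp (depProdEvalFst p π)).comp (free w))).1
  obtain ⟨y, hy⟩ := R.nm_dvd_res_nm (depProdEvalSnd p π) k (free w) (free (pt L))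
    (DFunLike.congr_fun hsq) (fun s t hst _ => hinj (congrArg (p.comp (depProdEvalFst p π)) hst))
    (R.res a x)
  rw [map_mul, hy, ← mul_assoc, ← R.res_comp, ← R.res_comp,
    hom_point_ext ((depProdBase p π).comp k) (toPoint (orbit L)), hu]

end TambaraFunctor

namespace IsImprimitivityIdempotent

open TambaraFunctor FinGSet

variable {G : Type u} [Group G] [Finite G] {R : TambaraFunctor.{u, v} G} {H : Subgroup G}
  {d : R.obj (orbit ⊥)} (hd : IsImprimitivityIdempotent H d)
include hd

theorem res_eq_res {a b : orbit (⊥ : Subgroup G) →[G] orbit ⊥}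
    (h : (free (pt H)).comp a = (free (pt H)).comp b) : R.res a d = R.res b d := by
  obtain ⟨g, rfl⟩ := exists_eq_rightMul a
  obtain ⟨k, rfl⟩ := exists_eq_rightMul b
  rw [← smul_eq_res_rightMul, ← smul_eq_res_rightMul, eq_comm, ← inv_smul_eq_iff, smul_smul]
  exact hd.smul_eq _ ((free_comp_rightMul_eq_iff H g k).mp h)

theorem res_mul_res_eq_zero {a b : orbit (⊥ : Subgroup G) →[G] orbit ⊥}
    (h : (free (pt H)).comp a ≠ (free (pt H)).comp b) : R.res a d * R.res b d = 0 := by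
  obtain ⟨g, rfl⟩ := exists_eq_rightMul a
  obtain ⟨k, rfl⟩ := exists_eq_rightMul b
  have hgk := hd.mul_smul_eq_zero _ (mt (free_comp_rightMul_eq_iff H g k).mpr h)
  rw [← smul_eq_res_rightMul, ← smul_eq_res_rightMul, ← smul_inv_smul g (k • d), ← smul_mul',
    smul_smul, hgk, smul_zero]

theorem isIdempotentElem_cosetNorm : IsIdempotentElem (R.cosetNorm H d) :=
  hd.isIdempotentElem.map (R.nm (free (pt H)))

theorem isIdempotentElem_res_cosetNorm {X : FinGSet G} (b : X →[G] orbit H) :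
    IsIdempotentElem (R.res b (R.cosetNorm H d)) :=
  hd.isIdempotentElem_cosetNorm.map (R.res b)

theorem res_cosetNorm_eq_nm {L : Subgroup G} {g : orbit L →[G] orbit H}
    {v : orbit ⊥ →[G] orbit L} {r : orbit (⊥ : Subgroup G) →[G] orbit ⊥}
    (h : (free (pt H)).comp r = g.comp v) :
    R.res g (R.cosetNorm H d) = R.nm v (R.res r d) := by
  have hP : Nonempty (pullback (free (pt H)) g) :=
    ⟨⟨(r (pt ⊥), v (pt ⊥)), DFunLike.congr_fun h (pt ⊥)⟩⟩
  rw [cosetNorm, R.res_nm _ _ _ _ (isCartesian_pullback (free (pt H)) g)]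
  refine nm_eq_of_forall_orbit _ ((hd.isIdempotentElem.map (R.res r)).map (R.nm v)) _ fun K k => ?_
  let fst := (pullbackFst (free (pt H)) g).comp k
  let snd := (pullbackSnd (free (pt H)) g).comp k
  obtain ⟨w, rfl⟩ := exists_free_lift snd v
  have hw : Function.Bijective w :=
    ((bijective_of_orbit_to_free fst).of_comp_iff' w).mp (bijective_of_orbit_to_free (fst.comp w))
  have hfst : (free (pt H)).comp (fst.comp w) = (free (pt H)).comp r := by
    rw [h]
    exact congrArg (fun q => (q.comp k).comp w) (comp_pullbackFst (free (pt H)) g)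
  rw [← R.nm_comp_res_of_bijective snd w hw, ← R.res_comp, ← R.res_comp]
  exact congrArg _ (hd.res_eq_res hfst)

theorem res_free_cosetNorm : R.res (free (pt H)) (R.cosetNorm H d) = d := by
  rw [hd.res_cosetNorm_eq_nm (v := MulActionHom.id G) (r := MulActionHom.id G) rfl, R.res_id,
    R.nm_id]

theorem nm_orbit_res_cosetNorm {K L : Subgroup G} (f : orbit K →[G] orbit L)
    (b : orbit L →[G] orbit H) :
    R.nm f (R.res (b.comp f) (R.cosetNorm H d)) = R.res b (R.cosetNorm H d) := by
  obtain ⟨r, hr⟩ := exists_free_lift (free (pt H)) ((b.comp f).comp (free (pt K)))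
  rw [hd.res_cosetNorm_eq_nm hr, ← R.nm_comp]
  exact (hd.res_cosetNorm_eq_nm (g := b) (v := f.comp (free (pt K))) hr).symm

theorem nm_res_cosetNorm {X Y : FinGSet G} (f : X →[G] Y) (hf : Function.Surjective f)
    (b : Y →[G] orbit H) :
    R.nm f (R.res (b.comp f) (R.cosetNorm H d)) = R.res b (R.cosetNorm H d) := by
  refine ext_orbit fun K g => ?_
  obtain ⟨p, hp⟩ := hf (g (pt K))
  have : Nonempty (pullback f g) := ⟨⟨(p, pt K), hp⟩⟩
  rw [R.res_nm _ _ _ _ (isCartesian_pullback f g), ← R.res_comp, ← R.res_comp]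
  refine nm_eq_of_forall_orbit _ (hd.isIdempotentElem_res_cosetNorm _) _ fun L k => ?_
  rw [← R.res_comp, ← hd.nm_orbit_res_cosetNorm ((pullbackSnd f g).comp k)]
  exact congrArg (fun q => R.nm _ (R.res ((b.comp q).comp k) _)) (comp_pullbackFst f g)

theorem res_cosetNorm_mul_eq_zero {W : FinGSet G} {a b : W →[G] orbit H} (h : ∀ w, a w ≠ b w) :
    R.res a (R.cosetNorm H d) * R.res b (R.cosetNorm H d) = 0 := by
  refine ext_orbit fun K f => ?_
  obtain ⟨r, hr⟩ := exists_free_lift (free (pt H)) ((a.comp f).comp (free (pt K)))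
  obtain ⟨s, hs⟩ := exists_free_lift (free (pt H)) ((b.comp f).comp (free (pt K)))
  have hrs : (free (pt H)).comp r ≠ (free (pt H)).comp s := fun e =>
    h _ (DFunLike.congr_fun (hr.symm.trans (e.trans hs)) (pt ⊥))
  rw [map_mul, ← R.res_comp, ← R.res_comp, hd.res_cosetNorm_eq_nm hr, hd.res_cosetNorm_eq_nm hs,
    ← map_mul, hd.res_mul_res_eq_zero hrs, nm_orbit_zero, map_zero]

/-- In the double coset formula for `res f (tr f y)` only the diagonal survives multiplication by
the idempotent, as it is orthogonal to its translates. -/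
theorem res_tr_mul_res_cosetNorm {W Y : FinGSet G} (f : W →[G] Y) (b : W →[G] orbit H)
    (h : ∀ w w', f w = f w' → b w = b w' → w = w') {y : R.obj W}
    (hy : y * R.res b (R.cosetNorm H d) = y) :
    R.res f (R.tr f y) * R.res b (R.cosetNorm H d) = y := by
  let δ : W →[G] pullback f f :=
    pullbackLift f f (MulActionHom.id G) (MulActionHom.id G) fun _ => rfl
  have hδ : Function.Injective δ := fun w w' hw => congrArg (pullbackFst f f) hw
  have h_fst : (pullbackFst f f).comp δ = MulActionHom.id G := rfl
  have h_snd : (pullbackSnd f f).comp δ = MulActionHom.id G := rfl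
  have h_off_diagonal : R.res (complIncl δ) (R.res (pullbackFst f f) y *
      R.res (pullbackSnd f f) (R.res b (R.cosetNorm H d))) = 0 := by
    conv_lhs => rw [← hy]
    rw [map_mul, map_mul, map_mul, mul_assoc, ← R.res_comp, ← R.res_comp, ← R.res_comp b,
      ← R.res_comp, ← R.res_comp, hd.res_cosetNorm_mul_eq_zero, mul_zero]
    exact fun w hw => w.2 w.1.1.1 (Subtype.ext (Prod.ext rfl (h _ _ w.1.2 hw)))
  rw [R.res_tr _ _ _ _ (isCartesian_pullback f f), tr_mul,
    tr_eq_add (isDisjointUnion_compl δ hδ), h_off_diagonal, map_zero, add_zero, map_mul,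
    ← R.res_comp, ← R.res_comp, h_fst, h_snd, R.tr_id, R.res_id, R.res_id, hy]

theorem res_trCosetNorm_mul_cosetNorm :
    R.res (toPoint (orbit H)) (R.trCosetNorm H d) * R.cosetNorm H d = R.cosetNorm H d := by
  have h := hd.res_tr_mul_res_cosetNorm (toPoint (orbit H)) (MulActionHom.id G) (fun _ _ _ h => h)
    (y := R.cosetNorm H d) (by rw [R.res_id, hd.isIdempotentElem_cosetNorm.eq])
  rwa [R.res_id] at h

theorem res_trCosetNorm_mul_res_cosetNorm {X : FinGSet G} (b : X →[G] orbit H) :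
    R.res (toPoint X) (R.trCosetNorm H d) * R.res b (R.cosetNorm H d) =
      R.res b (R.cosetNorm H d) := by
  rw [← res_res_toPoint b, ← map_mul, hd.res_trCosetNorm_mul_cosetNorm]

theorem isIdempotentElem_trCosetNorm : IsIdempotentElem (R.trCosetNorm H d) := by
  have h : R.trCosetNorm H d * R.tr (toPoint (orbit H)) (R.cosetNorm H d) =
      R.tr (toPoint (orbit H)) (R.cosetNorm H d) := by
    rw [mul_tr, hd.res_trCosetNorm_mul_cosetNorm]
  exact h

theorem nm_free_res_cosetNorm_eq_zero {L : Subgroup G} {k : orbit ⊥ →[G] orbit H}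
    (hL : ¬ L ≤ MulAction.stabilizer G (k (pt ⊥))) :
    R.nm (free (pt L)) (R.res k (R.cosetNorm H d)) = 0 := by
  obtain ⟨l, hl, hlk⟩ := SetLike.not_le_iff_exists.mp hL
  have hne : ∀ w, k w ≠ k.comp (rightMul l) w := fun w hw => hlk <| by
    have := (orbit_hom_ext w hw).trans (comp_rightMul k l)
    rw [MulAction.mem_stabilizer_iff, ← free_pt (l • _), ← this]
  rw [← ((hd.isIdempotentElem_res_cosetNorm k).map (R.nm (free (pt L)))).eq]
  conv_lhs => enter [2]; rw [← nm_free_pt_res_comp_rightMul hl]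
  rw [← map_mul, hd.res_cosetNorm_mul_eq_zero hne, nm_orbit_zero]

theorem res_trCosetNorm_mul_nm_free (L : Subgroup G) (k : orbit ⊥ →[G] orbit H) :
    R.res (toPoint (orbit L)) (R.trCosetNorm H d) *
      R.nm (free (pt L)) (R.res k (R.cosetNorm H d)) =
        R.nm (free (pt L)) (R.res k (R.cosetNorm H d)) := by
  by_cases hL : L ≤ MulAction.stabilizer G (k (pt ⊥))
  · have hk : k = (orbitTo L (k (pt ⊥)) hL).comp (free (pt L)) := by
      rw [comp_free, orbitTo_pt, ← eq_free]
    rw [hk, hd.nm_orbit_res_cosetNorm, hd.res_trCosetNorm_mul_res_cosetNorm]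
  · rw [hd.nm_free_res_cosetNorm_eq_zero hL, mul_zero]

/-- The restrictions of `cosetNorm H d`, as a family of idempotents of `R` over the subgroup `H`. -/
noncomputable def idempotentFamily : IdempotentFamily (R.restrictGroup H) where
  e X := R.res (induceBase X) (R.cosetNorm H d)
  isIdempotentElem X := hd.isIdempotentElem_res_cosetNorm (induceBase X)
  res_e f := (R.res_comp (induceBase _) (induceMap f) _).symm
  nm_e f hf := hd.nm_res_cosetNorm (induceMap f) (Function.surjective_id.prodMap hf) (induceBase _)

end IsImprimitivityIdempotent

namespace TambaraFunctor

open FinGSet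

variable {G : Type u} [Group G] [Finite G] {R : TambaraFunctor.{u, v} G}

/-- The restrictions of the norm to `R(G/G)` of an idempotent that is fixed by all of `G`. -/
def fixedIdempotentFamily {d : R.obj (orbit ⊥)}
    (hd : IsImprimitivityIdempotent (⊤ : Subgroup G) d) : IdempotentFamily R where
  e X := R.res (toPoint X) (R.cosetNorm ⊤ d)
  isIdempotentElem X := hd.isIdempotentElem_res_cosetNorm (toPoint X)
  res_e f := res_res_toPoint f _
  nm_e f hf := hd.nm_res_cosetNorm f hf (toPoint _)

theorem IsDomainLike.eq_one_of_forall_smul_eq (h : R.IsDomainLike) {d : R.obj (orbit ⊥)}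
    (hd : IsIdempotentElem d) (h_smul : ∀ g : G, g • d = d) (h_ne : d ≠ 0) : d = 1 := by
  have hd' : IsImprimitivityIdempotent (⊤ : Subgroup G) d :=
    ⟨hd, fun g _ => h_smul g, fun g hg => (hg (Subgroup.mem_top g)).elim⟩
  have he : (fixedIdempotentFamily hd').e (orbit ⊥) = d :=
    (congrArg (R.res · _) (hom_point_ext _ _)).trans hd'.res_free_cosetNorm
  have h01 := (fixedIdempotentFamily hd').e_eq_zero_or_eq_one h ⊥
  rw [he] at h01
  exact h01.resolve_left h_ne

theorem IsDomainLike.trCosetNorm_eq_one (h : R.IsDomainLike) {H : Subgroup G}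
    {d : R.obj (orbit ⊥)} (hd : IsImprimitivityIdempotent H d) (h_ne : d ≠ 0) :
    R.trCosetNorm H d = 1 := by
  refine eq_one_of_forall_mul_nm_res (A := orbit H) (x := R.cosetNorm H d) ?_
    hd.res_trCosetNorm_mul_nm_free
  refine h.eq_one_of_forall_smul_eq (hd.isIdempotentElem_trCosetNorm.map (R.res _))
    (fun g => res_res_toPoint (rightMul g) _) fun h0 => h_ne ?_
  have hmul := hd.res_trCosetNorm_mul_res_cosetNorm (free (pt H))
  rwa [hd.res_free_cosetNorm, trCosetNorm, h0, zero_mul, eq_comm] at hmul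

end TambaraFunctor

/-! ### Descent to the corner -/

namespace TambaraFunctor

open FinGSet

variable {G : Type u} [Group G] [Finite G] (R : TambaraFunctor.{u, v} G) (H : Subgroup G)

/-- The unit, at a finite `G`-set `X`, of the adjunction between restriction and coinduction. -/
noncomputable def coindUnit (X : FinGSet G) :
    R.obj X →+* (R.restrictGroup H).obj (restrict H X) :=
  R.res (induceCounit H X)

variable {R H}

theorem coindUnit_res {X Y : FinGSet G} (f : X →[G] Y) (y : R.obj Y) :
    R.coindUnit H X (R.res f y) =
      (R.restrictGroup H).res (restrictMap H f) (R.coindUnit H Y y) :=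
  (R.res_comp f (induceCounit H X) y).symm.trans <|
    (congrArg (R.res · y) (MulActionHom.ext (isCartesian_induceCounit f).1)).trans
      (R.res_comp (induceCounit H Y) (induceMap (restrictMap H f)) y)

theorem coindUnit_tr {X Y : FinGSet G} (f : X →[G] Y) (x : R.obj X) :
    R.coindUnit H Y (R.tr f x) =
      (R.restrictGroup H).tr (restrictMap H f) (R.coindUnit H X x) :=
  R.res_tr _ _ _ _ (isCartesian_induceCounit f) x

theorem coindUnit_nm {X Y : FinGSet G} (f : X →[G] Y) (x : R.obj X) :
    R.coindUnit H Y (R.nm f x) =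
      (R.restrictGroup H).nm (restrictMap H f) (R.coindUnit H X x) :=
  R.res_nm _ _ _ _ (isCartesian_induceCounit f) x

end TambaraFunctor

namespace IsImprimitivityIdempotent

open TambaraFunctor FinGSet

variable {G : Type u} [Group G] [Finite G] {R : TambaraFunctor.{u, v} G} {H : Subgroup G}
  {d : R.obj (orbit ⊥)} (hd : IsImprimitivityIdempotent H d)

theorem tr_induceCounit_idempotentFamily_e (h : R.trCosetNorm H d = 1) (X : FinGSet G) :
    R.tr (induceCounit H X) (hd.idempotentFamily.e (restrict H X)) = 1 := by
  have h_res := R.res_tr _ _ _ _ (isCartesian_induceBase H X) (R.cosetNorm H d)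
  rw [hom_point_ext (toPoint _) (toPoint (orbit H))] at h_res
  exact h_res.symm.trans ((congrArg _ h).trans (map_one _))

/-- The value at `X` of the isomorphism of `R` with the functor coinduced from the corner. -/
noncomputable def coindEquivObj (h : R.trCosetNorm H d = 1) (X : FinGSet G) :
    R.obj X ≃+* hd.idempotentFamily.corner.obj (restrict H X) where
  __ := (hd.idempotentFamily.toCorner (restrict H X)).comp (R.coindUnit H X)
  invFun y := R.tr (induceCounit H X) y.1
  left_inv x := (R.mul_tr (induceCounit H X) _ x).symm.trans <| by
    rw [hd.tr_induceCounit_idempotentFamily_e h, mul_one]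
  right_inv y := Subtype.ext <| hd.res_tr_mul_res_cosetNorm (induceCounit H X) (induceBase _)
    (by
      rintro ⟨c, x⟩ ⟨c', x'⟩ hcx hc
      obtain rfl : c = c' := hc
      exact Prod.ext rfl (smul_left_cancel (α := G) (β := X.carrier) c.out hcx))
    (hd.idempotentFamily.coe_mul_e y)

/-- The isomorphism of `R` with the functor coinduced from the corner of its restriction. -/
noncomputable def isoCoind (h : R.trCosetNorm H d = 1) :
    Iso R (coind H hd.idempotentFamily.corner) where
  equiv := hd.coindEquivObj h
  map_res f a := Subtype.ext <| (congrArg (· * hd.idempotentFamily.e _) (coindUnit_res f a)).trans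
    (hd.idempotentFamily.res_mul_e (restrictMap H f) _)
  map_tr f a := Subtype.ext <| (congrArg (· * hd.idempotentFamily.e _) (coindUnit_tr f a)).trans
    (hd.idempotentFamily.tr_mul_e (restrictMap H f) _)
  map_nm f a := Subtype.ext <| (congrArg (· * hd.idempotentFamily.e _) (coindUnit_nm f a)).trans
    (hd.idempotentFamily.nm_mul_e (restrictMap H f) _).symm

theorem isClarified_corner (hmin : ∀ d', d' ≠ 0 → IsIdempotentElem d' → d ∣ d' →
    ∀ h ∈ H, d' * h • d' ≠ 0) : hd.idempotentFamily.corner.IsClarified := by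
  rintro ⟨δ, hδ_ne, hδ, h, hδh⟩
  let x : R.obj (induce H (orbit ⊥)) := δ.1
  have hx_ne : x ≠ 0 := fun hx => hδ_ne (Subtype.ext hx)
  have hx : IsIdempotentElem x := congrArg Subtype.val hδ
  have hxh : x * R.res (induceMap (rightMul h)) x = 0 := congrArg Subtype.val hδh
  have hxe : x * R.res (induceBase (orbit ⊥)) (R.cosetNorm H d) = x :=
    hd.idempotentFamily.coe_mul_e δ
  refine hmin (R.res (freeToInduce H) x) ?_ (hx.map (R.res (freeToInduce H))) ?_ h h.2 ?_
  · rwa [Ne, map_eq_zero_iff _ (R.res_injective_of_bijective _ (freeToInduce_bijective H))]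
  · refine ⟨R.res (freeToInduce H) x, ?_⟩
    conv_lhs => rw [← hxe]
    rw [map_mul, ← R.res_comp, induceBase_comp_freeToInduce, hd.res_free_cosetNorm, mul_comm]
  · rw [smul_eq_res_rightMul, ← R.res_comp, ← induceMap_rightMul_comp_freeToInduce, R.res_comp,
      ← map_mul, hxh, map_zero]

end IsImprimitivityIdempotent

theorem mainTheorem8 {G : Type u} [Group G] [Finite G] (R : TambaraFunctor.{u, v} G) :
    R.IsDomainLike ↔
      ∃ (H : Subgroup G) (S : TambaraFunctor.{u, v} H),
        S.IsClarified ∧ S.IsDomainLike ∧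
          Nonempty (TambaraFunctor.Iso R (TambaraFunctor.coind H S)) := by
  constructor
  · intro hR
    have := ((TambaraFunctor.isDomainLike_iff R).mp hR).1
    obtain ⟨H, d, h_ne, hd, hmin⟩ :=
      exists_isImprimitivityIdempotent G (R.obj (FinGSet.orbit (⊥ : Subgroup G)))
    let Φ := hd.isoCoind (hR.trCosetNorm_eq_one hd h_ne)
    exact ⟨H, hd.idempotentFamily.corner, hd.isClarified_corner hmin,
      TambaraFunctor.isDomainLike_coind_iff.mp (Φ.isDomainLike_iff.mp hR), ⟨Φ⟩⟩
  · rintro ⟨H, S, -, hS, ⟨Φ⟩⟩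
    exact Φ.isDomainLike_iff.mpr (TambaraFunctor.isDomainLike_coind_iff.mpr hS)
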